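/- Let $H(3;\mathbb C)$ be the complex Heisenberg group of the matrices $\begin{pmatrix}1&z^1&z^3\\0&1&z^2\\0&0&1\end{pmatrix}$, let $\Gamma=H(3;\mathbb Z[i])$ be the subgroup of those with Gaussian-integer entries, and let $M=\Gamma\backslash H(3;\mathbb C)$ be the compact $6$-dimensional nilmanifold underlying the Iwasawa manifold. Let $e^1,\dots,e^6$ be the left-invariant real coframe with $e^1+ie^2=dz^1$, $e^3+ie^4=dz^2$, $e^5+ie^6=z^1dz^2-dz^3$, so that $de^1=\dots=de^4=0$, $de^5=e^{13}-e^{24}$, $de^6=e^{14}+e^{23}$. For $t\in[0,1]$ put $c=\cos(\pi t)$, $s=\sin(\pi t)$, and let $J_t$ be the endomorphism of $TM$ whose dual action $\xi\mapsto J_t\xi:=\xi\circ J_t$ on $1$-forms is $$J_te^1=-e^2,\quad J_te^2=e^1,\quad J_te^3=-c\,e^4-s\,e^6,\quad J_te^4=c\,e^3-s\,e^5,\quad J_te^5=s\,e^4-c\,e^6,\quad J_te^6=s\,e^3+c\,e^5 .$$ For an almost-complex structure $J$ on $M$, forms of type $(1,0)$ are those with $\xi\circ J=i\xi$, $\wedge^{p,q}_JM$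 denotes the complex forms of type $(p,q)$, and $H^{(p,q)}_J(M)\subseteq H^{p+q}_{dR}(M;\mathbb C)$ is the subspace of classes having a $d$-closed representative in $\wedge^{p,q}_JM$. $J$ is complex-$\mathcal C^\infty$-full at the $k$-th stage in the sense of Li and Zhang if $\sum_{p+q=k}H^{(p,q)}_J(M)=H^k_{dR}(M;\mathbb C)$. A left-invariant $J$, with $\mathfrak g^{1,0}$ its space of left-invariant $(1,0)$-forms, is holomorphically-parallelizable if $d\,\mathfrak g^{1,0}\subseteq\wedge^{2,0}$ and Abelian if $d\,\mathfrak g^{1,0}\subseteq\wedge^{1,1}$. A generalized-almost-complex structure on $M$ is a smooth endomorphism $\mathcal J$ of $TM\oplus T^*M$ with $\mathcal J^2=-\mathrm{id}$, orthogonal for $\langle X+\xi,Y+\eta\rangle=\frac12(\xi(Y)+\eta(X))$. Let $L$ be its $i$-eigenbundle in $(TM\oplus T^*M)\otimes\mathbb C$, $U$ the line bundle of complex forms of mixed degree annihilated by the Clifford action $(X+\xi)\cdot\varphi=\iota_X\varphi+\xi\wedge\varphi$ of $L$, and $U^k=\wedge^{3-k}\bar L\cdot U$. Let $GH_{dR}(M)=\ker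 d/\operatorname{im}d$ on complex forms of mixed degree, and let $GH^{(k)}_{\mathcal J}(M)$ be its subspace of classes with a $d$-closed representative in $U^k$. $\mathcal J$ is $\mathcal C^\infty$-pure-and-full if $GH_{dR}(M)=\bigoplus_{k\in\mathbb Z}GH^{(k)}_{\mathcal J}(M)$. An almost-complex structure $J$ is viewed as the generalized-almost-complex structure $\mathcal J_J(X+\xi)=-JX+\xi\circ J$. Put $\varphi_t^1=e^1+ie^2$, $\varphi_t^2=e^3+i(c\,e^4+s\,e^6)$, $\varphi_t^3=e^5-i(s\,e^4-c\,e^6)$. Then: 1. $(J_t)_{t\in[0,1]}$ is a smooth curve of left-invariant almost-complex structures on $M$, each $\mathcal J_{J_t}$ is a generalized-almost-complex structure, and the $(1,0)$-covectors of $J_t$ are spanned at each point by $\varphi^1_t,\varphi^2_t,\varphi^3_t$. 2. $J_0$ is the complex structure of the Iwasawa manifold, induced by multiplication by $i$ in the coordinates $z^1,z^2,z^3$; it satisfies $J_0e^1=-e^2$, $J_0e^3=-e^4$, $J_0e^5=-e^6$ and is holomorphically-parallelizable. $J_1$ satisfies $J_1e^1=-e^2$, $J_1e^3=e^4$, $J_1e^5=e^6$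 and is Abelian. 3. For $t\in\{0,1\}$, the spaces $H^{(1,0)}_{J_t}(M)=\mathbb C\langle[\varphi_t^1],[\varphi_t^2]\rangle$ and $H^{(0,1)}_{J_t}(M)=\mathbb C\langle[\bar\varphi_t^1],[\bar\varphi_t^2]\rangle$ are two-dimensional. 4. For every $t\in(0,1)$, the spaces $H^{(1,0)}_{J_t}(M)=\mathbb C\langle[\varphi_t^1]\rangle$ and $H^{(0,1)}_{J_t}(M)=\mathbb C\langle[\bar\varphi_t^1]\rangle$ are one-dimensional. Hence $J_t$ is not complex-$\mathcal C^\infty$-full at the first stage in the sense of Li and Zhang, and $\mathcal J_{J_t}$ is not $\mathcal C^\infty$-pure-and-full as a generalized-almost-complex structure. -/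

import Mathlib

open scoped ContDiff TensorProduct Matrix

noncomputable section

namespace Iwasawa

/-! ### The Iwasawa nilmanifold -/

/-- The underlying space of the Heisenberg group `H(3;ℂ)`, in the global coordinates
`(z¹, z², z³) = (z 0, z 1, z 2)` given by the entries of the matrices `heisMatrix z`. -/
abbrev G : Type := Fin 3 → ℂ

/-- The element of `H(3;ℂ)` with coordinates `z`. -/
def heisMatrix (z : G) : Matrix (Fin 3) (Fin 3) ℂ :=
  !![1, z 0, z 2;
     0, 1, z 1;
     0, 0, 1]

/-- The group law of `H(3;ℂ)` in the coordinates; `heisMul a` is left translation by `a`. -/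
def heisMul (a x : G) : G := ![a 0 + x 0, a 1 + x 1, a 2 + x 2 + a 0 * x 1]

/-- `heisMul` is the multiplication of matrices. -/
theorem heisMatrix_heisMul (a x : G) : heisMatrix (heisMul a x) = heisMatrix a * heisMatrix x := by
  ext i j
  fin_cases i <;> fin_cases j <;> simp [heisMatrix, heisMul, Matrix.mul_apply, Fin.sum_univ_three]
  all_goals ring

/-- The lattice `Γ = H(3;ℤ[i])`: the matrices in `H(3;ℂ)` with Gaussian integer entries. The
compact nilmanifold is `M = Γ \ H(3;ℂ)`. -/
def lattice : Set G := {a | ∀ j, ∃ m : GaussianInt, a j = GaussianInt.toComplex m}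

theorem contDiff_heisMul (a : G) : ContDiff ℝ ∞ (heisMul a) := by
  rw [contDiff_pi]
  intro i
  fin_cases i <;> simp [heisMul] <;> fun_prop

/-! ### Differential forms and de Rham cohomology of `M` -/

/-- Complex-valued alternating `k`-forms on a tangent space. All tangent spaces are identified
with `G` by the coordinates. -/
abbrev AForm (k : ℕ) : Type := G [⋀^Fin k]→L[ℝ] ℂ

/-- Pull-back of a differential form on `H(3;ℂ)` under left translation by `a`. -/
def pullback {k : ℕ} (a : G) (α : G → AForm k) : G → AForm k := fun x =>
  (α (heisMul a x)).compContinuousLinearMap (fderiv ℝ (heisMul a) x)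

/-- The smooth `k`-forms on `H(3;ℂ)` that are invariant under left translation by the elements of
`Γ`, as a complex vector space. -/
def formsSubmodule (k : ℕ) : Submodule ℂ (G → AForm k) where
  carrier := {α | ContDiff ℝ ∞ α ∧ ∀ a ∈ lattice, pullback a α = α}
  add_mem' := by
    rintro α η ⟨h1, h2⟩ ⟨h3, h4⟩
    refine ⟨h1.add h3, fun a ha => ?_⟩
    conv_rhs => rw [← h2 a ha, ← h4 a ha]
    rfl
  zero_mem' := ⟨contDiff_const, fun _ _ => rfl⟩
  smul_mem' := by
    rintro c α ⟨h1, h2⟩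
    refine ⟨h1.const_smul c, fun a ha => ?_⟩
    conv_rhs => rw [← h2 a ha]
    rfl

/-- The space of smooth complex-valued differential `k`-forms on `M = Γ \ H(3;ℂ)`: forms on `M` are
identified, by pull-back along the covering `H(3;ℂ) → M`, with the smooth forms on `H(3;ℂ)` that
are invariant under the deck transformations, i.e. under left translation by `Γ`. -/
def Forms (k : ℕ) : Type := formsSubmodule k

instance (k : ℕ) : AddCommGroup (Forms k) := (formsSubmodule k).addCommGroup

instance (k : ℕ) : Module ℂ (Forms k) := (formsSubmodule k).module

/-- The value of a form at (the image in `M` of) a point of `H(3;ℂ)`. -/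
def Forms.toFun {k : ℕ} (α : Forms k) (x : G) : AForm k := α.1 x

/-- The exterior derivative of a `Γ`-invariant smooth form is again one. -/
theorem extDeriv_mem {k : ℕ} {α : G → AForm k} (hα : α ∈ formsSubmodule k) :
    extDeriv α ∈ formsSubmodule (k + 1) := by
  obtain ⟨h1, h2⟩ := hα
  refine ⟨?_, fun a ha => ?_⟩
  · have h : extDeriv α = fun x =>
        ContinuousAlternatingMap.alternatizeUncurryFinCLM ℝ G ℂ (fderiv ℝ α x) := by
      funext x
      simp [extDeriv]
    rw [h]
    exact (ContinuousAlternatingMap.alternatizeUncurryFinCLM ℝ G ℂ).contDiff.comp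
      (h1.fderiv_right (m := ∞) (by simp))
  conv_rhs => rw [← h2 a ha]
  funext x
  exact (extDeriv_pullback (h1.differentiable (by simp) _)
    (contDiff_heisMul a).contDiffAt (r := ∞)
    (by simpa using (WithTop.coe_le_coe.2 le_top : ((2 : ℕ∞) : WithTop ℕ∞) ≤ ∞))).symm

/-- The exterior derivative of forms on `M`. -/
def d (k : ℕ) : Forms k →ₗ[ℂ] Forms (k + 1) where
  toFun α := ⟨extDeriv α.1, extDeriv_mem α.2⟩
  map_add' α η := by
    apply Subtype.ext
    funext x
    exact extDeriv_add (α.2.1.differentiable (by simp) x) (η.2.1.differentiable (by simp) x)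
  map_smul' c α := by
    apply Subtype.ext
    funext x
    change extDeriv (c • α.1) x = c • extDeriv α.1 x
    rw [extDeriv, extDeriv, fderiv_const_smul (α.2.1.differentiable (by simp) x),
      ContinuousAlternatingMap.alternatizeUncurryFin_smul]

/-- The exact `k`-forms on `M`. -/
def exactForms : (k : ℕ) → Submodule ℂ (Forms k)
  | 0 => ⊥
  | k + 1 => LinearMap.range (d k)

/-- The closed `k`-forms on `M`. -/
abbrev closedForms (k : ℕ) : Submodule ℂ (Forms k) := LinearMap.ker (d k)

/-- The complex de Rham cohomology `H^k_dR(M;ℂ)`. -/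
abbrev DeRham (k : ℕ) : Type := closedForms k ⧸ (exactForms k).submoduleOf (closedForms k)

/-- The de Rham class of a closed form. -/
abbrev cls {k : ℕ} (α : closedForms k) : DeRham k := Submodule.Quotient.mk α

/-! ### Almost-complex structures on `M` and the subgroups `H^{(p,q)}_J(M)` -/

/-- Smooth almost-complex structures on `M`, as `Γ`-invariant fields on `H(3;ℂ)` of endomorphisms
of the tangent spaces. -/
structure IsAlmostComplex (J : G → G →L[ℝ] G) : Prop where
  smooth : ContDiff ℝ ∞ J
  sq : ∀ x, (J x).comp (J x) = -ContinuousLinearMap.id ℝ G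
  invariant : ∀ a ∈ lattice, ∀ x,
    (J (heisMul a x)).comp (fderiv ℝ (heisMul a) x) = (fderiv ℝ (heisMul a) x).comp (J x)

/-- `J` is invariant under all left translations of `H(3;ℂ)`. -/
def IsLeftInvariant (J : G → G →L[ℝ] G) : Prop :=
  ∀ a x, (J (heisMul a x)).comp (fderiv ℝ (heisMul a) x) = (fderiv ℝ (heisMul a) x).comp (J x)

/-- The exterior product `ξ ∧ α` of a covector `ξ` and a `k`-form `α`:
`(ξ ∧ α)(v₀,…,v_k) = ∑ i, (-1)^i ξ(v_i) α(v₀,…,v̂_i,…,v_k)`. -/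
def wedge {k : ℕ} (ξ : G →L[ℝ] ℂ) (α : AForm k) : AForm (k + 1) :=
  ContinuousAlternatingMap.alternatizeUncurryFin (ξ.smulRight α)

/-- The covectors of type `(1,0)` with respect to a linear complex structure `J`: the
`i`-eigenspace of `ξ ↦ ξ ∘ J`. -/
def covectors10 (J : G →L[ℝ] G) : Submodule ℂ (G →L[ℝ] ℂ) where
  carrier := {ξ | ∀ v, ξ (J v) = Complex.I * ξ v}
  add_mem' h1 h2 v := by simp [h1 v, h2 v, mul_add]
  zero_mem' v := by simp
  smul_mem' c ξ h v := by simp [h v, mul_left_comm]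

/-- The covectors of type `(0,1)`: the `-i`-eigenspace of `ξ ↦ ξ ∘ J`. -/
def covectors01 (J : G →L[ℝ] G) : Submodule ℂ (G →L[ℝ] ℂ) where
  carrier := {ξ | ∀ v, ξ (J v) = -Complex.I * ξ v}
  add_mem' h1 h2 v := by simp [h1 v, h2 v]; ring
  zero_mem' v := by simp
  smul_mem' c ξ h v := by simp [h v, mul_left_comm]

/-- The alternating `k`-forms of type `(p,q)` with respect to a linear complex structure `J`:
`typed J k p q` is the span of the exterior products of `p` covectors of type `(1,0)` and `q`
covectors of type `(0,1)` when `k = p + q`, and is zero when `k ≠ p + q`. -/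
def typed (J : G →L[ℝ] G) : (k p q : ℕ) → Submodule ℂ (AForm k)
  | 0, p, q => if p = 0 ∧ q = 0 then ⊤ else ⊥
  | k + 1, p, q => Submodule.span ℂ
      {β | (∃ p', p = p' + 1 ∧ ∃ ξ ∈ covectors10 J, ∃ α ∈ typed J k p' q, β = wedge ξ α) ∨
           (∃ q', q = q' + 1 ∧ ∃ ξ ∈ covectors01 J, ∃ α ∈ typed J k p q', β = wedge ξ α)}

/-- The space `∧^{p,q}_J M` of differential forms of degree `k` and type `(p,q)` on `M`. -/
def formsOfType (J : G → G →L[ℝ] G) (k p q : ℕ) : Submodule ℂ (Forms k) where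
  carrier := {α | ∀ x, α.toFun x ∈ typed (J x) k p q}
  add_mem' h1 h2 x := add_mem (h1 x) (h2 x)
  zero_mem' _ := zero_mem _
  smul_mem' c _ h x := Submodule.smul_mem _ c (h x)

/-- The subgroup `H^{(p,q)}_J(M) ⊆ H^k_dR(M;ℂ)`, `k = p + q`, of the classes that are represented
by a closed form of type `(p,q)`. -/
def HType (J : G → G →L[ℝ] G) (k p q : ℕ) : Submodule ℂ (DeRham k) :=
  ((formsOfType J k p q).submoduleOf (closedForms k)).map (Submodule.mkQ _)

/-- `J` is complex-`C^∞`-full at the `k`-th stage in the sense of Li and Zhang: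
`∑_{p+q=k} H^{(p,q)}_J(M) = H^k_dR(M;ℂ)`. -/
def IsFullAtStage (J : G → G →L[ℝ] G) (k : ℕ) : Prop :=
  ⨆ (p : ℕ) (q : ℕ) (_ : p + q = k), HType J k p q = ⊤

/-- `α` is a left-invariant differential form on `H(3;ℂ)`, i.e. an element of `∧^k 𝔤*_ℂ`. -/
def IsLeftInvariantForm {k : ℕ} (α : G → AForm k) : Prop := ∀ a, pullback a α = α

/-- `d(𝔤^{1,0}) ⊆ ∧^{2,0}(𝔤*_ℂ)`. -/
def IsHolomorphicallyParallelizable (J : G → G →L[ℝ] G) : Prop :=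
  ∀ α : G → AForm 1, IsLeftInvariantForm α → (∀ x, α x ∈ typed (J x) 1 1 0) →
    ∀ x, extDeriv α x ∈ typed (J x) 2 2 0

/-- `d(𝔤^{1,0}) ⊆ ∧^{1,1}(𝔤*_ℂ)`. -/
def IsAbelian (J : G → G →L[ℝ] G) : Prop :=
  ∀ α : G → AForm 1, IsLeftInvariantForm α → (∀ x, α x ∈ typed (J x) 1 1 0) →
    ∀ x, extDeriv α x ∈ typed (J x) 2 1 1

/-! ### Generalized-almost-complex structures on `M` and the subgroups `GH^{(k)}` -/

/-- The fibre `T ⊕ T*` at a point. -/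
abbrev GenTangent : Type := G × (G →L[ℝ] ℝ)

/-- The natural pairing `⟨X + ξ, Y + η⟩ = (ξ(Y) + η(X)) / 2` on `T ⊕ T*`. -/
def pairing (v w : GenTangent) : ℝ := (v.2 w.1 + w.2 v.1) / 2

/-- `w ∈ (T ⊕ T*)` at `heisMul a x` is the image of `v ∈ (T ⊕ T*)` at `x` under left translation
by `a`. -/
def IsTranslate (a x : G) (v w : GenTangent) : Prop :=
  w.1 = fderiv ℝ (heisMul a) x v.1 ∧ v.2 = w.2.comp (fderiv ℝ (heisMul a) x)

/-- Smooth generalized-almost-complex structures on `M`, as `Γ`-invariant fields on `H(3;ℂ)` of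
orthogonal endomorphisms of `T ⊕ T*` with square `-id`. -/
structure IsGenAlmostComplex (𝒥 : G → GenTangent →L[ℝ] GenTangent) : Prop where
  smooth : ContDiff ℝ ∞ 𝒥
  sq : ∀ x, (𝒥 x).comp (𝒥 x) = -ContinuousLinearMap.id ℝ GenTangent
  orthogonal : ∀ x v w, pairing (𝒥 x v) (𝒥 x w) = pairing v w
  invariant : ∀ a ∈ lattice, ∀ x v w, IsTranslate a x v w →
    IsTranslate a x (𝒥 x v) (𝒥 (heisMul a x) w)

/-- The generalized-almost-complex structure `X + ξ ↦ -J X + J* ξ` of an almost-complex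
structure `J`, with `J* ξ = ξ ∘ J`. -/
def genOfAlmostComplex (J : G → G →L[ℝ] G) : G → GenTangent →L[ℝ] GenTangent := fun x =>
  ContinuousLinearMap.prodMap (-(J x)) (ContinuousLinearMap.precomp ℝ (J x))

/-- The exterior algebra `∧^• T* ⊗ ℂ` at a point: forms of mixed degree. (Only the degrees
`k ≤ 6` contribute.) -/
abbrev MixedForm : Type := (k : ℕ) → AForm k

theorem wedge_add_left {k : ℕ} (ξ η : G →L[ℝ] ℂ) (α : AForm k) :
    wedge (ξ + η) α = wedge ξ α + wedge η α := by
  ext v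
  simp [wedge, ContinuousAlternatingMap.alternatizeUncurryFin_apply, add_mul,
    Finset.sum_add_distrib]

theorem wedge_add_right {k : ℕ} (ξ : G →L[ℝ] ℂ) (α β : AForm k) :
    wedge ξ (α + β) = wedge ξ α + wedge ξ β := by
  ext v
  simp [wedge, ContinuousAlternatingMap.alternatizeUncurryFin_apply,
    Finset.sum_add_distrib]

theorem wedge_smul_left {k : ℕ} (r : ℝ) (ξ : G →L[ℝ] ℂ) (α : AForm k) :
    wedge (r • ξ) α = r • wedge ξ α := by
  ext v
  simp only [wedge, ContinuousAlternatingMap.alternatizeUncurryFin_apply,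
    ContinuousAlternatingMap.smul_apply, Finset.smul_sum]
  refine Finset.sum_congr rfl fun i _ => ?_
  simp
  ring

theorem wedge_smul_right {k : ℕ} (c : ℂ) (ξ : G →L[ℝ] ℂ) (α : AForm k) :
    wedge ξ (c • α) = c • wedge ξ α := by
  ext v
  simp only [wedge, ContinuousAlternatingMap.alternatizeUncurryFin_apply,
    ContinuousAlternatingMap.smul_apply, Finset.smul_sum]
  refine Finset.sum_congr rfl fun i _ => ?_
  simp
  ring

/-- The Clifford action `(X + ξ) · φ = ι_X φ + ξ ∧ φ` on forms of mixed degree; the interior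
product `ι_X` is `curryLeft` and lowers the degree by one. -/
def cliffordFun (v : GenTangent) (φ : MixedForm) : MixedForm
  | 0 => (φ 1).curryLeft v.1
  | k + 1 => (φ (k + 2)).curryLeft v.1 + wedge (Complex.ofRealCLM.comp v.2) (φ k)

/-- The Clifford action of `T ⊕ T*`, as a real-linear map to the complex-linear endomorphisms. -/
def clifford : GenTangent →ₗ[ℝ] Module.End ℂ MixedForm where
  toFun v :=
    { toFun := cliffordFun v
      map_add' := fun φ ψ => by
        funext k
        cases k with
        | zero => rfl
        | succ k =>
          simp only [cliffordFun, Pi.add_apply, wedge_add_right,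
            ContinuousAlternatingMap.curryLeft_add, add_apply]
          abel
      map_smul' := fun c φ => by
        funext k
        cases k with
        | zero => rfl
        | succ k =>
          simp only [cliffordFun, Pi.smul_apply, wedge_smul_right, RingHom.id_apply, smul_add]
          rfl }
  map_add' v w := by
    ext1 φ
    funext k
    cases k with
    | zero => simp [cliffordFun]
    | succ k =>
      simp only [LinearMap.coe_mk, AddHom.coe_mk, cliffordFun, LinearMap.add_apply, Pi.add_apply,
        Prod.fst_add, Prod.snd_add, map_add, ContinuousLinearMap.comp_add, wedge_add_left]
      abel
  map_smul' r v := by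
    ext1 φ
    funext k
    cases k with
    | zero => simp [cliffordFun]
    | succ k =>
      simp only [LinearMap.coe_mk, AddHom.coe_mk, cliffordFun, LinearMap.smul_apply, Pi.smul_apply,
        Prod.smul_fst, Prod.smul_snd, map_smul, ContinuousLinearMap.comp_smul, wedge_smul_left,
        smul_add, RingHom.id_apply]

/-- The complex-linear extension of the Clifford action to `(T ⊕ T*) ⊗ ℂ`. -/
def cliffordC : (ℂ ⊗[ℝ] GenTangent) →ₗ[ℂ] Module.End ℂ MixedForm :=
  LinearMap.liftBaseChange ℂ clifford

/-- The eigenspace for `μ` of the complex-linear extension of `𝒥` to `(T ⊕ T*) ⊗ ℂ`. The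
eigenspace for `i` is `L`, and the one for `-i` is the conjugate `L̄`. -/
def eigenbundle (𝒥 : GenTangent →L[ℝ] GenTangent) (μ : ℂ) : Submodule ℂ (ℂ ⊗[ℝ] GenTangent) :=
  Module.End.eigenspace ((𝒥 : GenTangent →ₗ[ℝ] GenTangent).baseChange ℂ) μ

/-- The canonical line `U`: the forms annihilated by the Clifford action of `L`. -/
def canonicalLine (𝒥 : GenTangent →L[ℝ] GenTangent) : Submodule ℂ MixedForm :=
  ⨅ v ∈ eigenbundle 𝒥 Complex.I, LinearMap.ker (cliffordC v)

/-- `∧^m L̄ · U`. -/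
def spinorGrade (𝒥 : GenTangent →L[ℝ] GenTangent) : ℕ → Submodule ℂ MixedForm
  | 0 => canonicalLine 𝒥
  | m + 1 => Submodule.span ℂ
      {ψ | ∃ v ∈ eigenbundle 𝒥 (-Complex.I), ∃ φ ∈ spinorGrade 𝒥 m, ψ = cliffordC v φ}

/-- `U^k = ∧^{n-k} L̄ · U` with `2n = 6`. -/
def gradeU (𝒥 : GenTangent →L[ℝ] GenTangent) (k : ℤ) : Submodule ℂ MixedForm :=
  if k ≤ 3 then spinorGrade 𝒥 (3 - k).toNat else ⊥

/-- Differential forms of mixed degree on `M`. -/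
abbrev TotalForms : Type := (k : ℕ) → Forms k

/-- The exterior derivative on forms of mixed degree. -/
def dTotal : TotalForms →ₗ[ℂ] TotalForms where
  toFun α
    | 0 => 0
    | k + 1 => d k (α k)
  map_add' α η := by
    funext k
    cases k <;> simp
  map_smul' c α := by
    funext k
    cases k <;> simp

/-- The closed forms of mixed degree. -/
abbrev closedTotal : Submodule ℂ TotalForms := LinearMap.ker dTotal

/-- `GH_dR(M) = ker d / im d`, on forms of mixed degree. -/
abbrev GHdR : Type := closedTotal ⧸ (LinearMap.range dTotal).submoduleOf closedTotal

/-- The forms of mixed degree on `M` with values in `U^k`. -/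
def formsInU (𝒥 : G → GenTangent →L[ℝ] GenTangent) (k : ℤ) : Submodule ℂ TotalForms where
  carrier := {α | ∀ x, (fun j => (α j).toFun x) ∈ gradeU (𝒥 x) k}
  add_mem' h1 h2 x := add_mem (h1 x) (h2 x)
  zero_mem' x := zero_mem (gradeU (𝒥 x) k)
  smul_mem' c _ h x := Submodule.smul_mem _ c (h x)

/-- The subgroup `GH^{(k)}_𝒥(M) ⊆ GH_dR(M)` of the classes represented by a closed form with
values in `U^k`. -/
def GH (𝒥 : G → GenTangent →L[ℝ] GenTangent) (k : ℤ) : Submodule ℂ GHdR :=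
  ((formsInU 𝒥 k).submoduleOf closedTotal).map (Submodule.mkQ _)

/-- `C^∞`-pure: the sum of the `GH^{(k)}` is direct. -/
def IsGenPure (𝒥 : G → GenTangent →L[ℝ] GenTangent) : Prop := iSupIndep (GH 𝒥)

/-- `C^∞`-full: the `GH^{(k)}` span `GH_dR(M)`. -/
def IsGenFull (𝒥 : G → GenTangent →L[ℝ] GenTangent) : Prop := ⨆ k, GH 𝒥 k = ⊤

/-- `C^∞`-pure-and-full. -/
def IsGenPureAndFull (𝒥 : G → GenTangent →L[ℝ] GenTangent) : Prop := IsGenPure 𝒥 ∧ IsGenFull 𝒥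

/-! ### The curve `J_t` -/

/-- The left-invariant complex `1`-forms `dz¹`, `dz²`, `z¹ dz² - dz³`, which are
`e¹ + i e²`, `e³ + i e⁴`, `e⁵ + i e⁶`. -/
def complexCoframe (x : G) : Fin 3 → (G →L[ℝ] ℂ) :=
  ![ContinuousLinearMap.proj 0, ContinuousLinearMap.proj 1,
    x 0 • ContinuousLinearMap.proj 1 - ContinuousLinearMap.proj 2]

/-- The left-invariant real coframe `e¹, …, e⁶` (here `e 0, …, e 5`). -/
def e : Fin 6 → G → (G →L[ℝ] ℝ) := fun i x =>
  ![Complex.reCLM.comp (complexCoframe x 0), Complex.imCLM.comp (complexCoframe x 0),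
    Complex.reCLM.comp (complexCoframe x 1), Complex.imCLM.comp (complexCoframe x 1),
    Complex.reCLM.comp (complexCoframe x 2), Complex.imCLM.comp (complexCoframe x 2)] i

/-- The left-invariant frame `e_1, …, e_6` dual to `e¹, …, e⁶`. -/
def frame : Fin 6 → G → G := fun i x =>
  ![![1, 0, 0], ![Complex.I, 0, 0],
    ![0, 1, x 0], ![0, Complex.I, x 0 * Complex.I],
    ![0, 0, -1], ![0, 0, -Complex.I]] i

/-- The matrix of `J_t`. -/
def JMatrix (t : ℝ) : Matrix (Fin 6) (Fin 6) ℝ :=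
  let c := Real.cos (Real.pi * t)
  let s := Real.sin (Real.pi * t)
  !![ 0, 1,  0, 0,  0, 0;
     -1, 0,  0, 0,  0, 0;
      0, 0,  0, c,  0, s;
      0, 0, -c, 0,  s, 0;
      0, 0,  0, -s, 0, c;
      0, 0, -s, 0, -c, 0]

/-- The curve `J_t`: the endomorphism field whose dual action on covectors has the matrix
`JMatrix t` in the basis `e¹, …, e⁶`, i.e. `e^j ∘ J_t = ∑ i, (JMatrix t) i j • e^i`; on tangent
vectors, `J_t e_i = ∑ j, (JMatrix t) i j • e_j`. -/
def Jt (t : ℝ) : G → G →L[ℝ] G := fun x =>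
  ∑ i, ∑ j, JMatrix t i j • (e i x).smulRight (frame j x)

/-- The covector fields `φ_t¹, φ_t², φ_t³` (here `phiCov t 0, …, phiCov t 2`). -/
def phiCov (t : ℝ) (j : Fin 3) (x : G) : G →L[ℝ] ℂ :=
  let c := Real.cos (Real.pi * t)
  let s := Real.sin (Real.pi * t)
  let E : Fin 6 → (G →L[ℝ] ℂ) := fun i => Complex.ofRealCLM.comp (e i x)
  ![E 0 + Complex.I • E 1,
    E 2 + Complex.I • (c • E 3 + s • E 5),
    E 4 - Complex.I • (s • E 3 - c • E 5)] j

/-- The conjugate covector of `ξ`. -/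
def conjCov (ξ : G →L[ℝ] ℂ) : G →L[ℝ] ℂ := (Complex.conjCLE : ℂ →L[ℝ] ℂ).comp ξ

/-- A field of covectors as a differential form of degree one. -/
def oneForm (ξ : G → G →L[ℝ] ℂ) : G → AForm 1 := fun x =>
  ContinuousAlternatingMap.ofSubsingleton ℝ G ℂ (0 : Fin 1) (ξ x)

/-- `φ_t^j` as a form of degree one. -/
def phi (t : ℝ) (j : Fin 3) : G → AForm 1 := oneForm (phiCov t j)

/-- The conjugate of `φ_t^j` as a form of degree one. -/
def phiBar (t : ℝ) (j : Fin 3) : G → AForm 1 := oneForm fun x => conjCov (phiCov t j x)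

end Iwasawa

end

open Iwasawa

/-! Degree-one cohomology is computed by hand. A closed 1-form on `M` lifts to `df` on the
contractible group, and the periods of `f` are a homomorphism from the lattice to ℂ. Such a
homomorphism kills the centre, since central lattice elements are commutators, so it is determined
by four numbers `n`. Subtracting the matching combination of `e¹, …, e⁴` makes the periods vanish
and leaves `dF` with `F` a function on `M` (`exists_eq_coframeCov_add`). Thus ℂ⁴ maps onto the first
cohomology, and it maps injectively by averaging (`coframeClass_injective`).

The type condition is tested by averaging too. If `n·e + dF` is an eigenvector of `J_t` for `μ =
±i`, evaluation on frame vectors expresses `n₁ - μn₀`, `c n₃ - μn₂` and `s n₃` as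
constant-coefficient derivatives of `F`. The directions involved lie either in the plane `z² = z³ =
0` or in the abelian subgroup `z¹ = 0`. On the corresponding tori a derivative of a periodic
function has integral zero, so all three constants vanish (`mem_typeCoeffs`), and the invariant form
`n·e` is itself of the given type (`coframeCov_Jt`). For `s = 0` this leaves a plane of
coefficients. For `s ≠ 0` it forces `n₃ = n₂ = 0` and leaves a line. The class of `e⁴` is then
missed, so fullness at the first stage fails.

For the generalized statement, let `D` be the derivation of forms extending `ξ ↦ ξ ∘ J`. It
satisfies `[D, v·] = (𝒥v)·` for the Clifford action, so Clifford multiplication by the conjugate of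
`L` lowers `D`-weights by `i`. The canonical line sits in degree 3 with weight `3i`, hence `U^k` has
weight `ki` (`hasWeight_of_mem_spinorGrade`). The degree-one part of a closed form in `U^k` is
therefore closed of type (1,0) for `k = 1`, of type (0,1) for `k = -1`, and zero otherwise.
Generalized fullness would thus imply fullness at the first stage (`IsGenFull.isFullAtStage_one`).
-/

noncomputable section

namespace Iwasawa

/-! ### The left-invariant frame and coframe -/

/-- The coordinate `zʲ` as a real-linear map. -/
abbrev coordProj (j : Fin 3) : G →L[ℝ] ℂ := ContinuousLinearMap.proj j

theorem hasFDerivAt_heisMul (a x : G) :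
    HasFDerivAt (heisMul a) (ContinuousLinearMap.pi
      ![coordProj 0, coordProj 1, coordProj 2 + a 0 • coordProj 1]) x := by
  rw [hasFDerivAt_pi']
  intro i
  have h (j : Fin 3) := hasFDerivAt_apply (𝕜 := ℝ) (F' := fun _ : Fin 3 => ℂ) j x
  fin_cases i
  · exact (h 0).const_add (a 0)
  · exact (h 1).const_add (a 1)
  · exact ((h 2).const_add (a 2)).add ((h 1).const_mul (a 0))

theorem fderiv_heisMul_apply (a x v : G) :
    fderiv ℝ (heisMul a) x v = ![v 0, v 1, v 2 + a 0 * v 1] := by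
  rw [(hasFDerivAt_heisMul a x).fderiv]
  ext i
  fin_cases i <;> simp

theorem e_frame (i j : Fin 6) (x : G) : e i x (frame j x) = if i = j then 1 else 0 := by
  fin_cases i <;> fin_cases j <;> simp [e, frame, complexCoframe]

theorem sum_e_smul_frame (x v : G) : ∑ i, e i x v • frame i x = v := by
  ext j
  fin_cases j <;> apply Complex.ext <;>
    simp [Fin.sum_univ_succ, e, frame, complexCoframe] <;> ring

theorem map_eq_sum_frame {F : Type*} [AddCommGroup F] [Module ℝ F] [TopologicalSpace F]
    (f : G →L[ℝ] F) (x v : G) : f v = ∑ i, e i x v • f (frame i x) := by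
  conv_lhs => rw [← sum_e_smul_frame x v]
  simp only [map_sum, map_smul]

theorem fderiv_heisMul_frame (a x : G) (i : Fin 6) :
    fderiv ℝ (heisMul a) x (frame i x) = frame i (heisMul a x) := by
  rw [fderiv_heisMul_apply]
  fin_cases i <;> ext j <;> fin_cases j <;> simp [frame, heisMul] <;> ring

theorem e_heisMul (a x v : G) (i : Fin 6) :
    e i (heisMul a x) (fderiv ℝ (heisMul a) x v) = e i x v := by
  rw [map_eq_sum_frame (fderiv ℝ (heisMul a) x) x v]
  simp [fderiv_heisMul_frame, e_frame]

theorem contDiff_e (i : Fin 6) : ContDiff ℝ ∞ (e i) := by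
  have h : ContDiff ℝ ∞ fun x : G =>
      x 0 • coordProj 1 - coordProj 2 := by
    fun_prop
  fin_cases i
  · exact contDiff_const (c := Complex.reCLM.comp (coordProj 0))
  · exact contDiff_const (c := Complex.imCLM.comp (coordProj 0))
  · exact contDiff_const (c := Complex.reCLM.comp (coordProj 1))
  · exact contDiff_const (c := Complex.imCLM.comp (coordProj 1))
  · exact (contDiff_const (c := Complex.reCLM)).clm_comp h
  · exact (contDiff_const (c := Complex.imCLM)).clm_comp h

theorem contDiff_frame (i : Fin 6) : ContDiff ℝ ∞ (frame i) := by
  rw [contDiff_pi]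
  intro j
  fin_cases i <;> fin_cases j <;> simp [frame] <;> fun_prop

/-! ### The curve of almost-complex structures -/

theorem contDiff_Jt : ContDiff ℝ ∞ fun p : ℝ × G => Jt p.1 p.2 := by
  unfold Jt
  refine ContDiff.sum fun i _ => ContDiff.sum fun j _ => ?_
  refine ContDiff.smul (f := fun p : ℝ × G => JMatrix p.1 i j) ?_ ?_
  · fin_cases i <;> fin_cases j <;> simp [JMatrix] <;> fun_prop
  · exact ((contDiff_e i).comp contDiff_snd).smulRight ((contDiff_frame j).comp contDiff_snd)

theorem Jt_apply (t : ℝ) (x v : G) :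
    Jt t x v = ∑ i, ∑ j, (JMatrix t i j * e i x v) • frame j x := by
  simp [Jt, mul_smul]

theorem Jt_frame (t : ℝ) (x : G) (i : Fin 6) :
    Jt t x (frame i x) = ∑ j, JMatrix t i j • frame j x := by
  rw [Jt_apply, Finset.sum_eq_single i]
  · simp [e_frame]
  · intro k _ hk
    simp [e_frame, hk]
  · simp

theorem e_Jt (t : ℝ) (x v : G) (j : Fin 6) :
    e j x (Jt t x v) = ∑ i, JMatrix t i j * e i x v := by
  rw [Jt_apply]
  simp [e_frame]

theorem JMatrix_mul_self (t : ℝ) : JMatrix t * JMatrix t = -1 := by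
  have h := Real.sin_sq_add_cos_sq (Real.pi * t)
  ext i j
  fin_cases i <;> fin_cases j <;>
    simp [JMatrix, Matrix.mul_apply, Fin.sum_univ_succ] <;> linarith

theorem Jt_Jt (t : ℝ) (x v : G) : Jt t x (Jt t x v) = -v := by
  conv_rhs => rw [← sum_e_smul_frame x v]
  rw [Jt_apply, ← Finset.sum_neg_distrib, Finset.sum_comm]
  refine Finset.sum_congr rfl fun j _ => ?_
  rw [← Finset.sum_smul, ← neg_smul]
  congr 1
  simp only [e_Jt, Finset.mul_sum]
  rw [Finset.sum_comm]
  have h (k : Fin 6) : ∑ i, JMatrix t i j * (JMatrix t k i * e k x v)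
      = (JMatrix t * JMatrix t) k j * e k x v := by
    rw [Matrix.mul_apply, Finset.sum_mul]
    exact Finset.sum_congr rfl fun i _ => by ring
  simp [h, JMatrix_mul_self, Matrix.one_apply]

theorem isLeftInvariant_Jt (t : ℝ) : IsLeftInvariant (Jt t) := by
  intro a x
  ext1 v
  simp [Jt_apply, e_heisMul, map_sum, fderiv_heisMul_frame]

theorem contDiff_Jt_right (t : ℝ) : ContDiff ℝ ∞ (Jt t) :=
  ContDiff.comp (g := fun p : ℝ × G => Jt p.1 p.2) (f := fun x : G => (t, x)) contDiff_Jt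
    (contDiff_prodMk_right t)

theorem isAlmostComplex_Jt (t : ℝ) : IsAlmostComplex (Jt t) where
  smooth := contDiff_Jt_right t
  sq x := by
    ext1 v
    simp [Jt_Jt]
  invariant a _ x := isLeftInvariant_Jt t a x

/-- The opposite signs on vectors and covectors give orthogonality: `(ξ ∘ J)(-JY) = ξ(Y)`. -/
theorem IsAlmostComplex.isGenAlmostComplex {J : G → G →L[ℝ] G} (hJ : IsAlmostComplex J) :
    IsGenAlmostComplex (genOfAlmostComplex J) where
  smooth := by
    rw [contDiff_clm_apply_iff]
    rintro ⟨v, ξ⟩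
    exact (hJ.smooth.clm_apply contDiff_const).neg.prodMk (contDiff_const.clm_comp hJ.smooth)
  sq x := by
    have h (v : G) : J x (J x v) = -v := DFunLike.congr_fun (hJ.sq x) v
    refine ContinuousLinearMap.ext fun ⟨v, ξ⟩ => ?_
    refine Prod.ext ?_ ?_
    · simp [genOfAlmostComplex, h]
    · ext1 w
      simp [genOfAlmostComplex, h]
  orthogonal x v w := by
    have h (v : G) : J x (J x v) = -v := DFunLike.congr_fun (hJ.sq x) v
    simp [pairing, genOfAlmostComplex, h]
  invariant a ha x v w h := by
    have hx := hJ.invariant a ha x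
    refine ⟨?_, ?_⟩
    · have := DFunLike.congr_fun hx v.1
      simp only [ContinuousLinearMap.comp_apply] at this
      simp [genOfAlmostComplex, h.1, this]
    · ext1 u
      have := DFunLike.congr_fun hx u
      simp only [ContinuousLinearMap.comp_apply] at this
      simp [genOfAlmostComplex, h.2, this]

theorem Jt_zero (x v : G) : Jt 0 x v = Complex.I • v := by
  rw [Jt_apply]
  ext j
  fin_cases j <;> apply Complex.ext <;>
    simp [Fin.sum_univ_succ, JMatrix, e, frame, complexCoframe] <;> ring

theorem e_comp_Jt_zero (x : G) : (e 0 x).comp (Jt 0 x) = -e 1 x ∧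
    (e 2 x).comp (Jt 0 x) = -e 3 x ∧ (e 4 x).comp (Jt 0 x) = -e 5 x := by
  refine ⟨?_, ?_, ?_⟩ <;> ext1 v <;> simp [e_Jt, Fin.sum_univ_succ, JMatrix]

theorem e_comp_Jt_one (x : G) : (e 0 x).comp (Jt 1 x) = -e 1 x ∧
    (e 2 x).comp (Jt 1 x) = e 3 x ∧ (e 4 x).comp (Jt 1 x) = e 5 x := by
  refine ⟨?_, ?_, ?_⟩ <;> ext1 v <;> simp [e_Jt, Fin.sum_univ_succ, JMatrix]

theorem phiCov_mem_covectors10 (t : ℝ) (j : Fin 3) (x : G) :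
    phiCov t j x ∈ covectors10 (Jt t x) := by
  have h : (Real.sin (Real.pi * t) : ℂ) ^ 2 + (Real.cos (Real.pi * t) : ℂ) ^ 2 = 1 := by
    exact_mod_cast Real.sin_sq_add_cos_sq (Real.pi * t)
  have hI := Complex.I_mul_I
  intro v
  fin_cases j <;>
    simp [phiCov, e_Jt, Fin.sum_univ_succ, JMatrix, -Complex.ofReal_cos, -Complex.ofReal_sin]
  · linear_combination -(e 1 x v : ℂ) * hI
  · linear_combination Complex.I * (e 2 x v : ℂ) * h - ((Real.cos (Real.pi * t) : ℂ) * e 3 x v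
      + (Real.sin (Real.pi * t) : ℂ) * e 5 x v) * hI
  · linear_combination Complex.I * (e 4 x v : ℂ) * h + ((Real.sin (Real.pi * t) : ℂ) * e 3 x v
      - (Real.cos (Real.pi * t) : ℂ) * e 5 x v) * hI

theorem covectors10_Jt (t : ℝ) (x : G) :
    covectors10 (Jt t x) = Submodule.span ℂ (Set.range fun j => phiCov t j x) := by
  refine le_antisymm (fun ξ hξ => ?_) ?_
  · have hv := map_eq_sum_frame ξ x
    have h (i : Fin 6) := hξ (frame i x)
    have h0 := h 0
    have h3 := h 3
    have h5 := h 5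
    simp [Jt_frame, Fin.sum_univ_succ, JMatrix] at h0 h3 h5
    -- The `phiCov t j` are dual to `frame 0`, `frame 2`, `frame 4`. The eigenvalue equations `h0`,
    -- `h3`, `h5` determine `ξ` on the other three frame vectors from these.
    have : ξ = ξ (frame 0 x) • phiCov t 0 x + ξ (frame 2 x) • phiCov t 1 x
        + ξ (frame 4 x) • phiCov t 2 x := by
      ext1 v
      rw [hv v]
      simp [Fin.sum_univ_succ, phiCov]
      linear_combination (e 1 x v : ℂ) * h0 + Complex.I * e 3 x v * h3 + Complex.I * e 5 x v * h5
        + (ξ (frame 3 x) * e 3 x v + ξ (frame 5 x) * e 5 x v) * Complex.I_mul_I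
    rw [this]
    exact add_mem (add_mem (Submodule.smul_mem _ _ (Submodule.subset_span ⟨0, rfl⟩))
      (Submodule.smul_mem _ _ (Submodule.subset_span ⟨1, rfl⟩)))
      (Submodule.smul_mem _ _ (Submodule.subset_span ⟨2, rfl⟩))
  · rw [Submodule.span_le]
    rintro _ ⟨j, rfl⟩
    exact phiCov_mem_covectors10 t j x

/-! ### Forms of degree one -/

@[simp]
theorem oneForm_apply (ξ : G → G →L[ℝ] ℂ) (x : G) (v : Fin 1 → G) : oneForm ξ x v = ξ x (v 0) :=
  rfl

theorem wedge_apply {k : ℕ} (ξ : G →L[ℝ] ℂ) (α : AForm k) (v : Fin (k + 1) → G) :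
    wedge ξ α v = ∑ i : Fin (k + 1), (-1) ^ (i : ℕ) * (ξ (v i) * α (i.removeNth v)) := by
  simp [wedge, ContinuousAlternatingMap.alternatizeUncurryFin_apply]

theorem wedge_zero_form_apply (ξ : G →L[ℝ] ℂ) (α : AForm 0) (v : Fin 1 → G) :
    wedge ξ α v = α ![] * ξ (v 0) := by
  rw [wedge_apply, Fin.sum_univ_one]
  simp [mul_comm, Subsingleton.elim (Fin.removeNth 0 v) ![]]

theorem wedge_one_form_apply (ξ : G →L[ℝ] ℂ) (α : AForm 1) (v : Fin 2 → G) :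
    wedge ξ α v = ξ (v 0) * α ![v 1] - ξ (v 1) * α ![v 0] := by
  have h0 : Fin.removeNth 0 v = ![v 1] := by
    ext i; fin_cases i; rfl
  have h1 : Fin.removeNth 1 v = ![v 0] := by
    ext i; fin_cases i; rfl
  rw [wedge_apply, Fin.sum_univ_two, h0, h1]
  simp [sub_eq_add_neg]

/-- The covector underlying an alternating form of degree one. -/
def toCov (α : AForm 1) : G →L[ℝ] ℂ := (ContinuousAlternatingMap.ofSubsingleton ℝ G ℂ 0).symm α

theorem apply_eq_toCov (α : AForm 1) (v : Fin 1 → G) : α v = toCov α (v 0) := by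
  conv_lhs => rw [← (ContinuousAlternatingMap.ofSubsingleton ℝ G ℂ 0).apply_symm_apply α]
  rfl

theorem wedge_toCov (α : AForm 1) :
    wedge (toCov α) (ContinuousAlternatingMap.constOfIsEmpty ℝ G (Fin 0) 1) = α := by
  ext v
  simp [wedge_zero_form_apply, apply_eq_toCov]

theorem toCov_wedge (ξ : G →L[ℝ] ℂ) (α : AForm 0) : toCov (wedge ξ α) = α ![] • ξ := by
  ext1 v
  have := wedge_zero_form_apply ξ α ![v]
  rw [apply_eq_toCov] at this
  simpa using this

theorem mem_typed_one_one_zero {J : G →L[ℝ] G} {α : AForm 1} :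
    α ∈ typed J 1 1 0 ↔ toCov α ∈ covectors10 J := by
  constructor
  · intro h
    rw [typed] at h
    refine Submodule.span_induction (p := fun α _ => toCov α ∈ covectors10 J) ?_ ?_ ?_ ?_ h
    · rintro _ (⟨p, -, ξ, hξ, α, -, rfl⟩ | ⟨q, hq, -⟩)
      · rw [toCov_wedge]
        exact Submodule.smul_mem _ _ hξ
      · omega
    · exact zero_mem _
    · exact fun _ _ _ _ h1 h2 => add_mem h1 h2
    · exact fun c _ _ h1 => Submodule.smul_mem _ c h1
  · intro h
    rw [← wedge_toCov α, typed]
    exact Submodule.subset_span (Or.inl ⟨0, rfl, _, h, _, by simp [typed], rfl⟩)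

theorem mem_typed_one_zero_one {J : G →L[ℝ] G} {α : AForm 1} :
    α ∈ typed J 1 0 1 ↔ toCov α ∈ covectors01 J := by
  constructor
  · intro h
    rw [typed] at h
    refine Submodule.span_induction (p := fun α _ => toCov α ∈ covectors01 J) ?_ ?_ ?_ ?_ h
    · rintro _ (⟨p, hp, -⟩ | ⟨q, -, ξ, hξ, α, -, rfl⟩)
      · omega
      · rw [toCov_wedge]
        exact Submodule.smul_mem _ _ hξ
    · exact zero_mem _
    · exact fun _ _ _ _ h1 h2 => add_mem h1 h2
    · exact fun c _ _ h1 => Submodule.smul_mem _ c h1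
  · intro h
    rw [← wedge_toCov α, typed]
    exact Submodule.subset_span (Or.inr ⟨0, rfl, _, h, _, by simp [typed], rfl⟩)

theorem wedge_mem_typed_two_zero {J : G →L[ℝ] G} {ξ η : G →L[ℝ] ℂ} (hξ : ξ ∈ covectors10 J)
    (hη : η ∈ covectors10 J) :
    wedge ξ (ContinuousAlternatingMap.ofSubsingleton ℝ G ℂ 0 η) ∈ typed J 2 2 0 := by
  rw [typed]
  exact Submodule.subset_span
    (Or.inl ⟨1, rfl, ξ, hξ, _, mem_typed_one_one_zero.2 (by exact hη), rfl⟩)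

theorem wedge_mem_typed_one_one {J : G →L[ℝ] G} {ξ η : G →L[ℝ] ℂ} (hξ : ξ ∈ covectors01 J)
    (hη : η ∈ covectors10 J) :
    wedge ξ (ContinuousAlternatingMap.ofSubsingleton ℝ G ℂ 0 η) ∈ typed J 2 1 1 := by
  rw [typed]
  exact Submodule.subset_span
    (Or.inr ⟨0, rfl, ξ, hξ, _, mem_typed_one_one_zero.2 (by exact hη), rfl⟩)

/-! ### Exterior derivatives of invariant 1-forms and the structure equations at `t = 0, 1`. -/

theorem contDiff_oneForm {ξ : G → G →L[ℝ] ℂ} (hξ : ContDiff ℝ ∞ ξ) : ContDiff ℝ ∞ (oneForm ξ) :=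
  (ContinuousAlternatingMap.ofSubsingletonLIE (𝕜 := ℝ) (E := G) (F := ℂ)
    (0 : Fin 1)).contDiff.comp hξ

theorem extDeriv_oneForm_apply {ξ : G → G →L[ℝ] ℂ} (hξ : ContDiff ℝ ∞ ξ) (x : G)
    (v : Fin 2 → G) :
    extDeriv (oneForm ξ) x v = fderiv ℝ ξ x (v 0) (v 1) - fderiv ℝ ξ x (v 1) (v 0) := by
  have hd : Differentiable ℝ ξ := hξ.differentiable (by simp)
  rw [extDeriv_apply ((contDiff_oneForm hξ).differentiable (by simp) x), Fin.sum_univ_two]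
  have h (w u : G) : fderiv ℝ (fun y => ξ y w) x u = fderiv ℝ ξ x u w := by
    rw [fderiv_clm_apply (hd x) (differentiableAt_const w)]
    simp
  simp [h, Fin.removeNth, Fin.tail, sub_eq_add_neg]

theorem extDeriv_oneForm_const (ξ : G →L[ℝ] ℂ) (x : G) : extDeriv (oneForm fun _ => ξ) x = 0 := by
  ext v
  rw [extDeriv_oneForm_apply contDiff_const]
  simp

theorem isLeftInvariantForm_oneForm {ξ : G → G →L[ℝ] ℂ}
    (h : ∀ a x v, ξ (heisMul a x) (fderiv ℝ (heisMul a) x v) = ξ x v) :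
    IsLeftInvariantForm (oneForm ξ) := by
  intro a
  funext x
  ext v
  exact h a x (v 0)

theorem IsLeftInvariantForm.ext {k : ℕ} {α β : G → AForm k} (hα : IsLeftInvariantForm α)
    (hβ : IsLeftInvariantForm β) (h : α 0 = β 0) : α = β := by
  funext y
  have hy : heisMul y 0 = y := by
    ext i; fin_cases i <;> simp [heisMul]
  ext v
  -- Every tangent vector at `y` is the translate of one at the unit, obtained by inverting the
  -- shear in the third coordinate.
  have hv : v = fun i => fderiv ℝ (heisMul y) 0 ![v i 0, v i 1, v i 2 - y 0 * v i 1] := by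
    funext i
    rw [fderiv_heisMul_apply]
    ext j; fin_cases j <;> simp
  have h1 := congrFun (hα y) 0
  have h2 := congrFun (hβ y) 0
  rw [← h, ← h1] at h2
  simp only [pullback, hy] at h2
  have := DFunLike.congr_fun h2 fun i => ![v i 0, v i 1, v i 2 - y 0 * v i 1]
  rw [hv]
  exact this.symm

theorem phiCov_heisMul (t : ℝ) (j : Fin 3) (a x v : G) :
    phiCov t j (heisMul a x) (fderiv ℝ (heisMul a) x v) = phiCov t j x v := by
  fin_cases j <;> simp [phiCov, e_heisMul]

theorem contDiff_phiCov (t : ℝ) (j : Fin 3) : ContDiff ℝ ∞ (phiCov t j) := by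
  have h (i : Fin 6) : ContDiff ℝ ∞ fun x => Complex.ofRealCLM.comp (e i x) :=
    contDiff_const.clm_comp (contDiff_e i)
  fin_cases j
  · exact (h 0).add ((h 1).const_smul _)
  · exact (h 2).add ((((h 3).const_smul _).add ((h 5).const_smul _)).const_smul _)
  · exact (h 4).sub ((((h 3).const_smul _).sub ((h 5).const_smul _)).const_smul _)

/-- The coefficients are read off at the unit; both sides are left-invariant, so they agree
everywhere with the same constants. -/
theorem exists_eq_sum_phi {t : ℝ} {α : G → AForm 1} (hα : IsLeftInvariantForm α)
    (h : ∀ x, α x ∈ typed (Jt t x) 1 1 0) : ∃ a : Fin 3 → ℂ, α = ∑ j, a j • phi t j := by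
  have h0 := mem_typed_one_one_zero.1 (h 0)
  rw [covectors10_Jt, Submodule.mem_span_range_iff_exists_fun] at h0
  obtain ⟨a, ha⟩ := h0
  have hsum : ∑ j, a j • phi t j = oneForm fun x => ∑ j, a j • phiCov t j x := by
    funext x
    ext v
    simp [phi]
  refine ⟨a, ?_⟩
  rw [hsum]
  refine hα.ext (isLeftInvariantForm_oneForm fun b x v => ?_) ?_
  · simp [phiCov_heisMul]
  · ext v
    rw [apply_eq_toCov, ← ha]
    rfl

theorem extDeriv_mem_of_phi {t : ℝ} {p q : ℕ}
    (h : ∀ j x, extDeriv (phi t j) x ∈ typed (Jt t x) 2 p q) {α : G → AForm 1}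
    (hα : IsLeftInvariantForm α) (hα' : ∀ x, α x ∈ typed (Jt t x) 1 1 0) (x : G) :
    extDeriv α x ∈ typed (Jt t x) 2 p q := by
  obtain ⟨a, rfl⟩ := exists_eq_sum_phi hα hα'
  have hd (j : Fin 3) : DifferentiableAt ℝ (phi t j) x :=
    (contDiff_oneForm (contDiff_phiCov t j)).differentiable (by simp) x
  have hs (j : Fin 3) : extDeriv (a j • phi t j) x = a j • extDeriv (phi t j) x := by
    rw [extDeriv, extDeriv, fderiv_const_smul (hd j),
      ContinuousAlternatingMap.alternatizeUncurryFin_smul]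
  simp only [Fin.sum_univ_three]
  rw [extDeriv_add (((hd 0).const_smul _).add ((hd 1).const_smul _)) ((hd 2).const_smul _),
    extDeriv_add ((hd 0).const_smul _) ((hd 1).const_smul _), hs, hs, hs]
  exact add_mem (add_mem (Submodule.smul_mem _ _ (h 0 x)) (Submodule.smul_mem _ _ (h 1 x)))
    (Submodule.smul_mem _ _ (h 2 x))

/-- One structure equation for both endpoints: `κ` is the identity for `J_0` and conjugation for
`J_1`. -/
theorem extDeriv_comp_complexCoframe_two {κ : ℂ →L[ℝ] ℂ} (hκ : ∀ a b, κ (a * b) = κ a * κ b)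
    (x : G) : extDeriv (oneForm fun x => κ.comp (complexCoframe x 2)) x =
      wedge (κ.comp (coordProj 0)) (ContinuousAlternatingMap.ofSubsingleton ℝ G ℂ 0
        (κ.comp (coordProj 1))) := by
  have hc : ContDiff ℝ ∞ fun x : G => κ.comp (complexCoframe x 2) := by
    refine contDiff_const.clm_comp ?_
    change ContDiff ℝ ∞ fun x : G => x 0 • coordProj 1 - coordProj 2
    fun_prop
  have hd (u w : G) : fderiv ℝ (fun x : G => κ.comp (complexCoframe x 2)) x u w
      = κ (u 0) * κ (w 1) := by
    have h1 : HasFDerivAt (fun x : G => κ (complexCoframe x 2 w))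
        (κ.comp ((w 1) • coordProj 0)) x := by
      refine κ.hasFDerivAt.comp x ?_
      exact ((hasFDerivAt_apply (𝕜 := ℝ) (F' := fun _ : Fin 3 => ℂ) 0 x).mul_const (w 1)).sub_const
        (w 2)
    have h2 := fderiv_clm_apply (hc.differentiable (by simp) x) (differentiableAt_const w)
    have h3 := DFunLike.congr_fun (h1.fderiv.symm.trans h2) u
    simp at h3
    rw [← h3, ← hκ, mul_comm]
  ext v
  rw [extDeriv_oneForm_apply hc, wedge_one_form_apply, hd, hd]
  rfl

theorem isHolomorphicallyParallelizable_Jt_zero : IsHolomorphicallyParallelizable (Jt 0) := by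
  intro α hα hα' x
  refine extDeriv_mem_of_phi (fun j x => ?_) hα hα' x
  have h0 : phiCov 0 0 = fun _ => coordProj 0 := by
    funext x; ext1 v
    apply Complex.ext <;> simp [phiCov, e, complexCoframe]
  have h1 : phiCov 0 1 = fun _ => coordProj 1 := by
    funext x; ext1 v
    apply Complex.ext <;> simp [phiCov, e, complexCoframe]
  have h2 : phiCov 0 2 = fun x => (ContinuousLinearMap.id ℝ ℂ).comp (complexCoframe x 2) := by
    funext x; ext1 v
    apply Complex.ext <;> simp [phiCov, e, complexCoframe]
  fin_cases j
  · simp [phi, h0, extDeriv_oneForm_const]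
  · simp [phi, h1, extDeriv_oneForm_const]
  · have m0 := phiCov_mem_covectors10 0 0 x
    have m1 := phiCov_mem_covectors10 0 1 x
    rw [h0] at m0
    rw [h1] at m1
    simp only [phi, Fin.reduceFinMk, h2]
    rw [extDeriv_comp_complexCoframe_two (fun _ _ => rfl)]
    exact wedge_mem_typed_two_zero m0 m1

theorem conjCov_mem_covectors01 {J : G →L[ℝ] G} {ξ : G →L[ℝ] ℂ} (h : ξ ∈ covectors10 J) :
    conjCov ξ ∈ covectors01 J := by
  intro v
  have := h v
  simp [conjCov, this]

theorem isAbelian_Jt_one : IsAbelian (Jt 1) := by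
  intro α hα hα' x
  refine extDeriv_mem_of_phi (fun j x => ?_) hα hα' x
  have h0 : phiCov 1 0 = fun _ => coordProj 0 := by
    funext x; ext1 v
    apply Complex.ext <;> simp [phiCov, e, complexCoframe]
  have h1 : phiCov 1 1 = fun _ => conjCov (coordProj 1) := by
    funext x; ext1 v
    apply Complex.ext <;> simp [phiCov, e, complexCoframe, conjCov]
  have h2 : phiCov 1 2 = fun x => (Complex.conjCLE : ℂ →L[ℝ] ℂ).comp (complexCoframe x 2) := by
    funext x; ext1 v
    apply Complex.ext <;> simp [phiCov, e, complexCoframe]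
    ring
  fin_cases j
  · simp [phi, h0, extDeriv_oneForm_const]
  · simp [phi, h1, extDeriv_oneForm_const]
  · have m0 := conjCov_mem_covectors01 (phiCov_mem_covectors10 1 0 x)
    have m1 := phiCov_mem_covectors10 1 1 x
    rw [h0] at m0
    rw [h1] at m1
    simp only [phi, Fin.reduceFinMk, h2]
    -- The derivative is the conjugate of `dz¹ ∧ dz²`. For `J_1` the conjugate of `dz¹` has type
    -- (0,1), whereas the conjugate of `dz²` is `φ²`, of type (1,0).
    rw [extDeriv_comp_complexCoframe_two (fun a b => map_mul (starRingEnd ℂ) a b)]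
    exact wedge_mem_typed_one_one m0 m1

/-! ### Averaging over tori -/

/-- A constant that is a constant-coefficient first-order derivative of a periodic function
vanishes. -/
theorem eq_zero_of_sum_fderiv_periodic {n : ℕ} {f : (Fin (n + 1) → ℝ) → ℂ} (hf : ContDiff ℝ 1 f)
    (hp : ∀ i u, f (u + Pi.single i 1) = f u) {w : Fin (n + 1) → ℂ} {k : ℂ}
    (h : ∀ u, ∑ i, w i * fderiv ℝ f u (Pi.single i 1) = k) : k = 0 := by
  have hd := hf.differentiable one_ne_zero
  -- Divergence theorem on the unit cube for the field with components `w i * f`: its divergence is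
  -- the constant `k`, and by periodicity opposite faces cancel.
  have key := MeasureTheory.integral_divergence_of_hasFDerivAt_off_countable'
    (0 : Fin (n + 1) → ℝ) 1 zero_le_one (fun i u => w i * f u) (fun i u => w i • fderiv ℝ f u) ∅
    Set.countable_empty (fun i => (continuous_const.mul hf.continuous).continuousOn)
    (fun x _ i => (hd x).hasFDerivAt.const_mul (w i))
  simp only [smul_apply, smul_eq_mul, h] at key
  have hv : MeasureTheory.volume (Set.Icc (0 : Fin (n + 1) → ℝ) 1) = 1 := by
    simp [Real.volume_Icc_pi]
  have key' := key (MeasureTheory.integrableOn_const (by simp [hv]))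
  rw [Finset.sum_eq_zero] at key'
  · simpa [MeasureTheory.Measure.real, hv] using key'
  · intro i _
    have hi (x : Fin n → ℝ) : i.insertNth ((1 : Fin (n + 1) → ℝ) i) x
        = i.insertNth ((0 : Fin (n + 1) → ℝ) i) x + (Pi.single i 1 : Fin (n + 1) → ℝ) := by
      ext j
      refine Fin.succAboveCases i ?_ (fun j => ?_) j
      · simp
      · simp
    simp only [hi, hp, sub_self]

/-- The functions on `M`, as `Γ`-invariant functions on `H(3;ℂ)`. -/
def IsInvariantFun (F : G → ℂ) : Prop := ∀ a ∈ lattice, ∀ x, F (heisMul a x) = F x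

/-- No integration over `M` is needed: along a subgroup `ℝⁿ⁺¹` whose standard generators lie in the
lattice, an invariant function restricts to a periodic one. -/
theorem eq_zero_of_sum_fderiv_invariant {n : ℕ} {F : G → ℂ} (hF : ContDiff ℝ ∞ F)
    (hi : IsInvariantFun F) (P : (Fin (n + 1) → ℝ) →L[ℝ] G)
    (hP : ∀ u v, heisMul (P u) (P v) = P (u + v)) (hl : ∀ i, P (Pi.single i 1) ∈ lattice)
    {w : Fin (n + 1) → ℂ} {k : ℂ}
    (h : ∀ u, ∑ i, w i * fderiv ℝ F (P u) (P (Pi.single i 1)) = k) : k = 0 := by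
  refine eq_zero_of_sum_fderiv_periodic (f := fun u => F (P u)) (w := w)
    ((hF.comp P.contDiff).of_le (by simp)) (fun i u => ?_) (fun u => ?_)
  · rw [add_comm u, ← hP, hi _ (hl i)]
  · have hc (v : Fin (n + 1) → ℝ) : fderiv ℝ (fun u => F (P u)) u v = fderiv ℝ F (P u) (P v) := by
      have := (hF.differentiable (by simp) (P u)).hasFDerivAt.comp u P.hasFDerivAt
      rw [HasFDerivAt.fderiv (f := fun u => F (P u)) this]
      rfl
    simp only [hc, h]

theorem gaussian_one : ∃ m : GaussianInt, (1 : ℂ) = GaussianInt.toComplex m := ⟨1, by simp⟩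

theorem gaussian_I : ∃ m : GaussianInt, Complex.I = GaussianInt.toComplex m :=
  ⟨⟨0, 1⟩, by simp [GaussianInt.toComplex_def]⟩

theorem gaussian_zero : ∃ m : GaussianInt, (0 : ℂ) = GaussianInt.toComplex m := ⟨0, by simp⟩

theorem gaussian_neg {z : ℂ} (h : ∃ m : GaussianInt, z = GaussianInt.toComplex m) :
    ∃ m : GaussianInt, -z = GaussianInt.toComplex m := by
  obtain ⟨m, rfl⟩ := h
  exact ⟨-m, by simp⟩

theorem vec_mem_lattice {a b c : ℂ} (ha : ∃ m : GaussianInt, a = GaussianInt.toComplex m)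
    (hb : ∃ m : GaussianInt, b = GaussianInt.toComplex m)
    (hc : ∃ m : GaussianInt, c = GaussianInt.toComplex m) : ![a, b, c] ∈ lattice := by
  intro j
  fin_cases j
  · exact ha
  · exact hb
  · exact hc

theorem frame_zero_mem_lattice (i : Fin 6) : frame i 0 ∈ lattice := by
  have h0 := gaussian_zero
  have h1 := gaussian_one
  have hI := gaussian_I
  fin_cases i <;> simp only [frame, Pi.zero_apply, zero_mul]
  · exact vec_mem_lattice h1 h0 h0
  · exact vec_mem_lattice hI h0 h0
  · exact vec_mem_lattice h0 h1 h0
  · exact vec_mem_lattice h0 hI h0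
  · exact vec_mem_lattice h0 h0 (gaussian_neg h1)
  · exact vec_mem_lattice h0 h0 (gaussian_neg hI)

/-- The linear map of `ℝⁿ` to `H(3;ℂ)` spanned by the given vectors of the frame at the unit. -/
def frameEmb {n : ℕ} (s : Fin n → Fin 6) : (Fin n → ℝ) →L[ℝ] G :=
  ∑ i, (ContinuousLinearMap.proj i : (Fin n → ℝ) →L[ℝ] ℝ).smulRight (frame (s i) 0)

theorem frameEmb_apply {n : ℕ} (s : Fin n → Fin 6) (u : Fin n → ℝ) :
    frameEmb s u = ∑ i, u i • frame (s i) 0 := by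
  simp [frameEmb]

theorem frameEmb_single {n : ℕ} (s : Fin n → Fin 6) (i : Fin n) :
    frameEmb s (Pi.single i 1) = frame (s i) 0 := by
  rw [frameEmb_apply, Finset.sum_eq_single i]
  · simp
  · intro j _ hj
    simp [hj]
  · simp

/-- By `hs'` the chosen frame fields are constant along the subgroup, so invariant derivatives
become coordinate derivatives there. -/
theorem eq_zero_of_frame_derivative {F : G → ℂ} (hF : ContDiff ℝ ∞ F) (hi : IsInvariantFun F)
    {n : ℕ} (s : Fin (n + 1) → Fin 6)
    (hs : ∀ u v, heisMul (frameEmb s u) (frameEmb s v) = frameEmb s (u + v))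
    (hs' : ∀ u i, frame (s i) (frameEmb s u) = frame (s i) 0) {w : Fin (n + 1) → ℂ} {k : ℂ}
    (h : ∀ x, ∑ i, w i * fderiv ℝ F x (frame (s i) x) = k) : k = 0 := by
  refine eq_zero_of_sum_fderiv_invariant hF hi (frameEmb s) hs (fun i => ?_) (w := w) (fun u => ?_)
  · rw [frameEmb_single]
    exact frame_zero_mem_lattice (s i)
  · rw [← h (frameEmb s u)]
    simp only [frameEmb_single, hs']

/-- Restrict to the subgroup `z² = z³ = 0`, where the product is addition. -/
theorem eq_zero_of_base_derivative {F : G → ℂ} (hF : ContDiff ℝ ∞ F) (hi : IsInvariantFun F)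
    {w : Fin 2 → ℂ} {k : ℂ}
    (h : ∀ x, w 0 * fderiv ℝ F x (frame 0 x) + w 1 * fderiv ℝ F x (frame 1 x) = k) : k = 0 := by
  refine eq_zero_of_frame_derivative hF hi ![0, 1] (fun u v => ?_) (fun u i => ?_) (w := w)
    (fun x => ?_)
  · ext j
    fin_cases j <;> (simp [frameEmb_apply, frame, heisMul]; try ring)
  · fin_cases i <;> simp [frame]
  · rw [← h x]
    simp

/-- Restrict to the subgroup `z¹ = 0`: there the twisting term of the product and the
`z¹`-dependence of `frame 2`, `frame 3` both vanish. -/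
theorem eq_zero_of_fibre_derivative {F : G → ℂ} (hF : ContDiff ℝ ∞ F) (hi : IsInvariantFun F)
    {w : Fin 4 → ℂ} {k : ℂ}
    (h : ∀ x, w 0 * fderiv ℝ F x (frame 2 x) + w 1 * fderiv ℝ F x (frame 3 x)
      + w 2 * fderiv ℝ F x (frame 4 x) + w 3 * fderiv ℝ F x (frame 5 x) = k) : k = 0 := by
  refine eq_zero_of_frame_derivative hF hi ![2, 3, 4, 5] (fun u v => ?_) (fun u i => ?_) (w := w)
    (fun x => ?_)
  · ext j
    fin_cases j <;> simp [frameEmb_apply, Fin.sum_univ_four, frame, heisMul] <;> ring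
  · have hu : frameEmb ![2, 3, 4, 5] u 0 = 0 := by
      simp [frameEmb_apply, Fin.sum_univ_four, frame]
    fin_cases i <;> simp [frame, hu]
  · rw [← h x]
    simp [Fin.sum_univ_four]

/-! ### Characters of the lattice -/

theorem additive_gaussian_eq {f : GaussianInt → ℂ} (hf : ∀ a b, f (a + b) = f a + f b)
    (m : GaussianInt) : f m = m.re * f 1 + m.im * f ⟨0, 1⟩ := by
  let g : GaussianInt →+ ℂ := AddMonoidHom.mk' f hf
  have hm : m = m.re • (1 : GaussianInt) + m.im • (⟨0, 1⟩ : GaussianInt) := by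
    ext <;> simp
  have : g m = m.re • g 1 + m.im • g ⟨0, 1⟩ := by
    conv_lhs => rw [hm]
    rw [map_add, map_zsmul, map_zsmul]
  simpa [g] using this

theorem heisenberg_character_eq {r : GaussianInt → GaussianInt → GaussianInt → ℂ}
    (hr : ∀ a b c a' b' c', r (a + a') (b + b') (c + c' + a * b') = r a b c + r a' b' c')
    (a b c : GaussianInt) : r a b c = a.re * r 1 0 0 + a.im * r ⟨0, 1⟩ 0 0
      + b.re * r 0 1 0 + b.im * r 0 ⟨0, 1⟩ 0 := by
  have h3 : r 0 0 c = 0 := by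
    -- The central element `(0,0,c)` is the commutator of `(c,0,0)` and `(0,1,0)`; comparing their
    -- two products shows that `r` vanishes on it.
    have h1 := hr c 0 0 0 1 0
    have h2 := hr 0 1 0 c 0 0
    have h4 := hr 0 0 c c 1 0
    simp only [zero_add, add_zero, mul_one, mul_zero] at h1 h2 h4
    linear_combination h1 - h2 - h4
  have h1 := hr 0 b c a 0 0
  have h2 := hr 0 0 c 0 b 0
  simp only [zero_add, add_zero, mul_zero, zero_mul] at h1 h2
  have ha := additive_gaussian_eq (f := fun a => r a 0 0)
    (fun a a' => by simpa using hr a 0 0 a' 0 0) a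
  have hb := additive_gaussian_eq (f := fun b => r 0 b 0)
    (fun b b' => by simpa using hr 0 b 0 0 b' 0) b
  linear_combination h1 + h2 + h3 + ha + hb

/-! ### The first cohomology of `M` -/

theorem heisMul_assoc (a b c : G) : heisMul (heisMul a b) c = heisMul a (heisMul b c) := by
  ext j
  fin_cases j <;> simp [heisMul] <;> ring

/-- The covector field `n₀ e¹ + n₁ e² + n₂ e³ + n₃ e⁴`. -/
def coframeCov (n : Fin 4 → ℂ) (x : G) : G →L[ℝ] ℂ :=
  n 0 • Complex.ofRealCLM.comp (e 0 x) + n 1 • Complex.ofRealCLM.comp (e 1 x)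
    + n 2 • Complex.ofRealCLM.comp (e 2 x) + n 3 • Complex.ofRealCLM.comp (e 3 x)

theorem coframeCov_apply (n : Fin 4 → ℂ) (x v : G) :
    coframeCov n x v = n 0 * e 0 x v + n 1 * e 1 x v + n 2 * e 2 x v + n 3 * e 3 x v := by
  simp [coframeCov]

theorem coframeCov_const (n : Fin 4 → ℂ) (x : G) : coframeCov n x = coframeCov n 0 := rfl

theorem coframeCov_heisMul (n : Fin 4 → ℂ) (a x v : G) :
    coframeCov n (heisMul a x) (fderiv ℝ (heisMul a) x v) = coframeCov n x v := by
  simp [coframeCov_apply, e_heisMul]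

theorem coframeCov_zero_heisMul (n : Fin 4 → ℂ) (a x : G) :
    coframeCov n 0 (heisMul a x) = coframeCov n 0 a + coframeCov n 0 x := by
  simp [coframeCov_apply, e, complexCoframe, heisMul]
  ring

theorem coframeCov_frame (n : Fin 4 → ℂ) (x : G) (i : Fin 6) :
    coframeCov n x (frame i x) = ![n 0, n 1, n 2, n 3, 0, 0] i := by
  fin_cases i <;> simp [coframeCov_apply, e_frame]

/-- The closed form `n₀ e¹ + n₁ e² + n₂ e³ + n₃ e⁴` on `M`. -/
def closedCoframe : (Fin 4 → ℂ) →ₗ[ℂ] closedForms 1 where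
  toFun n := ⟨⟨oneForm (coframeCov n),
    contDiff_oneForm (funext (coframeCov_const n) ▸ contDiff_const),
    fun a _ => isLeftInvariantForm_oneForm (coframeCov_heisMul n) a⟩,
    LinearMap.mem_ker.2 (Subtype.ext (funext fun x =>
      (extDeriv_oneForm_const (coframeCov n 0) x :)))⟩
  map_add' n m := by
    apply Subtype.ext
    apply Subtype.ext
    funext x
    ext v
    change coframeCov (n + m) x (v 0) = coframeCov n x (v 0) + coframeCov m x (v 0)
    simp [coframeCov_apply]
    ring
  map_smul' c n := by
    apply Subtype.ext
    apply Subtype.ext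
    funext x
    ext v
    change coframeCov (c • n) x (v 0) = c * coframeCov n x (v 0)
    simp [coframeCov_apply]
    ring

theorem closedCoframe_toFun (n : Fin 4 → ℂ) :
    (closedCoframe n).1.toFun = oneForm (coframeCov n) := rfl

theorem oneForm_toCov (α : G → AForm 1) : oneForm (fun x => toCov (α x)) = α := by
  funext x
  ext v
  rw [oneForm_apply, apply_eq_toCov (α x)]

theorem contDiff_toCov {α : G → AForm 1} (hα : ContDiff ℝ ∞ α) :
    ContDiff ℝ ∞ fun x => toCov (α x) :=
  (ContinuousAlternatingMap.ofSubsingletonLIE (𝕜 := ℝ) (E := G) (F := ℂ)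
    (0 : Fin 1)).symm.contDiff.comp hα

theorem exists_primitive (α : closedForms 1) :
    ∃ f : G → ℂ, ContDiff ℝ ∞ f ∧ ∀ x, HasFDerivAt f (toCov (α.1.toFun x)) x := by
  have hs : ContDiff ℝ ∞ fun x => toCov (α.1.toFun x) := contDiff_toCov α.1.2.1
  have hd (x v w : G) : fderiv ℝ (fun x => toCov (α.1.toFun x)) x v w
      = fderiv ℝ (fun x => toCov (α.1.toFun x)) x w v := by
    have h := extDeriv_oneForm_apply hs x ![v, w]
    rw [oneForm_toCov] at h
    have h0 : extDeriv α.1.toFun x = 0 :=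
      congrArg (fun β : Forms 2 => β.toFun x) (LinearMap.mem_ker.1 α.2)
    rw [h0] at h
    simpa [sub_eq_zero] using h.symm
  obtain ⟨f, hf⟩ := convex_univ.exists_forall_hasFDerivAt_of_fderiv_symmetric isOpen_univ
    (hs.differentiable (by simp)).differentiableOn (fun x _ => hd x)
  have hf' (x : G) := hf x (Set.mem_univ x)
  refine ⟨f, contDiff_infty_iff_fderiv.2 ⟨fun x => (hf' x).differentiableAt, ?_⟩, hf'⟩
  rwa [funext fun x => (hf' x).fderiv]

/-- A primitive and its translate by a lattice element have the same differential, so they differ by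
a constant. -/
theorem exists_period {α : closedForms 1} {f : G → ℂ}
    (hf : ∀ x, HasFDerivAt f (toCov (α.1.toFun x)) x) {a : G} (ha : a ∈ lattice) (x : G) :
    f (heisMul a x) = f x + (f (heisMul a 0) - f 0) := by
  have hinv (x v : G) : toCov (α.1.toFun (heisMul a x)) (fderiv ℝ (heisMul a) x v)
      = toCov (α.1.toFun x) v :=
    DFunLike.congr_fun (congrFun (α.1.2.2 a ha) x) fun _ => v
  have hg (x : G) : HasFDerivAt (fun x => f (heisMul a x) - f x) (0 : G →L[ℝ] ℂ) x := by
    have h := ((hf (heisMul a x)).comp x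
      (hasFDerivAt_heisMul a x).differentiableAt.hasFDerivAt).sub (hf x)
    refine h.congr_fderiv ?_
    ext1 v
    simpa [sub_eq_zero] using hinv x v
  have := is_const_of_fderiv_eq_zero (fun x => (hg x).differentiableAt)
    (fun x => (hg x).fderiv) x 0
  linear_combination this

theorem exists_eq_coframeCov_add (α : closedForms 1) : ∃ (n : Fin 4 → ℂ) (F : G → ℂ),
    ContDiff ℝ ∞ F ∧ IsInvariantFun F ∧
      ∀ x, toCov (α.1.toFun x) = coframeCov n x + fderiv ℝ F x := by
  obtain ⟨f, hfs, hf⟩ := exists_primitive α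
  let ρ : G → ℂ := fun a => f (heisMul a 0) - f 0
  let vec : GaussianInt → GaussianInt → GaussianInt → G := fun a b c =>
    ![GaussianInt.toComplex a, GaussianInt.toComplex b, GaussianInt.toComplex c]
  have hvec (a b c) : vec a b c ∈ lattice := vec_mem_lattice ⟨a, rfl⟩ ⟨b, rfl⟩ ⟨c, rfl⟩
  have hρ (a b : G) (ha : a ∈ lattice) : ρ (heisMul a b) = ρ a + ρ b := by
    have := exists_period hf ha (heisMul b 0)
    simp only [ρ, heisMul_assoc, this]
    ring
  have hr (a b c a' b' c') : ρ (vec (a + a') (b + b') (c + c' + a * b'))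
      = ρ (vec a b c) + ρ (vec a' b' c') := by
    rw [← hρ _ _ (hvec a b c)]
    congr 1
    ext j
    fin_cases j <;> simp [vec, heisMul]
  have hchar := heisenberg_character_eq (r := fun a b c => ρ (vec a b c)) hr
  -- The periods on the non-central generators; the linear function `coframeCov n 0` then has the
  -- same periods as `f` on the whole lattice.
  let n : Fin 4 → ℂ := ![ρ (vec 1 0 0), ρ (vec ⟨0, 1⟩ 0 0), ρ (vec 0 1 0), ρ (vec 0 ⟨0, 1⟩ 0)]
  have hn (a : G) (ha : a ∈ lattice) : ρ a = coframeCov n 0 a := by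
    obtain ⟨a0, h0⟩ := ha 0
    obtain ⟨a1, h1⟩ := ha 1
    obtain ⟨a2, h2⟩ := ha 2
    have hav : a = vec a0 a1 a2 := by
      ext j
      fin_cases j <;> simp [vec, h0, h1, h2]
    have hre (m : GaussianInt) : (((GaussianInt.toComplex m).re : ℝ) : ℂ) = m.re := by
      rw [← GaussianInt.intCast_re, Complex.ofReal_intCast]
    have him (m : GaussianInt) : (((GaussianInt.toComplex m).im : ℝ) : ℂ) = m.im := by
      rw [← GaussianInt.intCast_im, Complex.ofReal_intCast]
    rw [hav, hchar]
    simp [coframeCov_apply, e, complexCoframe, n, vec, hre, him]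
    ring
  refine ⟨n, fun x => f x - coframeCov n 0 x, hfs.sub (coframeCov n 0).contDiff,
    fun a ha x => ?_, fun x => ?_⟩
  · beta_reduce
    rw [exists_period hf ha x, coframeCov_zero_heisMul, ← hn a ha]
    ring
  · have h := ((hf x).sub (coframeCov n 0).hasFDerivAt).fderiv
    change fderiv ℝ (fun x => f x - coframeCov n 0 x) x = _ at h
    rw [h, coframeCov_const]
    abel

/-- A function on `M` as a differential form of degree zero. -/
def zeroForm (F : G → ℂ) (hF : ContDiff ℝ ∞ F) (hi : IsInvariantFun F) : Forms 0 :=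
  ⟨fun x => ContinuousAlternatingMap.constOfIsEmpty ℝ G (Fin 0) (F x), by
    refine ⟨(ContinuousAlternatingMap.constOfIsEmptyLIE ℝ G ℂ (Fin 0)).contDiff.comp hF,
      fun a ha => ?_⟩
    funext x
    ext v
    exact hi a ha x⟩

theorem toCov_d_zeroForm {F : G → ℂ} (hF : ContDiff ℝ ∞ F) (hi : IsInvariantFun F) (x : G) :
    toCov ((d 0 (zeroForm F hF hi)).toFun x) = fderiv ℝ F x := by
  have h := extDeriv_constOfIsEmpty (𝕜 := ℝ) F x
  change toCov (extDeriv _ x) = _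
  rw [toCov, Equiv.symm_apply_eq]
  exact h

theorem exists_eq_zeroForm (β : Forms 0) : ∃ F hF hi, β = zeroForm F hF hi := by
  have hev : ContDiff ℝ ∞ fun x => β.toFun x 0 :=
    (ContinuousAlternatingMap.constOfIsEmptyLIE ℝ G ℂ (Fin 0)).symm.contDiff.comp β.2.1
  refine ⟨fun x => β.toFun x 0, hev, fun a ha x => ?_, ?_⟩
  · have h1 : (fun i => fderiv ℝ (heisMul a) x ((0 : Fin 0 → G) i)) = 0 := Subsingleton.elim _ _
    have h2 := DFunLike.congr_fun (congrFun (β.2.2 a ha) x) 0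
    exact (congrArg (β.toFun (heisMul a x)) h1).symm.trans h2
  · apply Subtype.ext
    funext x
    ext v
    rw [Subsingleton.elim v 0]
    rfl

theorem Forms.ext_toCov {α β : Forms 1} (h : ∀ x, toCov (α.toFun x) = toCov (β.toFun x)) :
    α = β := by
  apply Subtype.ext
  funext x
  exact (ContinuousAlternatingMap.ofSubsingleton ℝ G ℂ 0).symm.injective (h x)

theorem toCov_closedCoframe (n : Fin 4 → ℂ) (x : G) :
    toCov ((closedCoframe n).1.toFun x) = coframeCov n x := rfl

/-- The classes of the closed invariant forms `n₀ e¹ + n₁ e² + n₂ e³ + n₃ e⁴`. -/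
def coframeClass : (Fin 4 → ℂ) →ₗ[ℂ] DeRham 1 := (Submodule.mkQ _).comp closedCoframe

theorem coframeClass_apply (n : Fin 4 → ℂ) : coframeClass n = cls (closedCoframe n) := rfl

theorem cls_eq_coframeClass {α : closedForms 1} {n : Fin 4 → ℂ} {F : G → ℂ}
    (hF : ContDiff ℝ ∞ F) (hi : IsInvariantFun F)
    (h : ∀ x, toCov (α.1.toFun x) = coframeCov n x + fderiv ℝ F x) :
    cls α = coframeClass n := by
  rw [coframeClass_apply, Submodule.Quotient.eq]
  refine ⟨zeroForm F hF hi, Forms.ext_toCov fun x => ?_⟩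
  rw [toCov_d_zeroForm]
  change _ = toCov (α.1.toFun x) - toCov ((closedCoframe n).1.toFun x)
  rw [h, toCov_closedCoframe]
  abel

/-- If `n·e = dF`, each `n i` is a constant derivative of `F` along one frame vector, and averaging
kills it. -/
theorem coframeClass_injective : Function.Injective coframeClass := by
  rw [← LinearMap.ker_eq_bot, LinearMap.ker_eq_bot']
  intro n hn
  rw [coframeClass_apply, Submodule.Quotient.mk_eq_zero] at hn
  obtain ⟨β, hβ⟩ := hn
  obtain ⟨F, hF, hi, rfl⟩ := exists_eq_zeroForm β
  have h (x : G) : fderiv ℝ F x = coframeCov n x := by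
    rw [← toCov_d_zeroForm hF hi, hβ]
    rfl
  ext i
  fin_cases i
  · refine eq_zero_of_base_derivative hF hi (w := ![1, 0]) fun x => ?_
    simp [h, coframeCov_frame]
  · refine eq_zero_of_base_derivative hF hi (w := ![0, 1]) fun x => ?_
    simp [h, coframeCov_frame]
  · refine eq_zero_of_fibre_derivative hF hi (w := ![1, 0, 0, 0]) fun x => ?_
    simp [h, coframeCov_frame]
  · refine eq_zero_of_fibre_derivative hF hi (w := ![0, 1, 0, 0]) fun x => ?_
    simp [h, coframeCov_frame]

/-! ### The subgroups `H^{(1,0)}` and `H^{(0,1)}` -/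

/-- The coefficients `n` for which `n₀ e¹ + n₁ e² + n₂ e³ + n₃ e⁴` is an eigenvector of `J_t` for
the eigenvalue `μ = ± i`. -/
def typeCoeffs (t : ℝ) (μ : ℂ) : Submodule ℂ (Fin 4 → ℂ) where
  carrier := {n | n 1 = μ * n 0 ∧ (Real.cos (Real.pi * t) : ℂ) * n 3 = μ * n 2 ∧
    (Real.sin (Real.pi * t) : ℂ) * n 3 = 0}
  add_mem' := by
    rintro n m ⟨h1, h2, h3⟩ ⟨h4, h5, h6⟩
    refine ⟨?_, ?_, ?_⟩ <;> simp only [Pi.add_apply]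
    · linear_combination h1 + h4
    · linear_combination h2 + h5
    · linear_combination h3 + h6
  zero_mem' := by simp
  smul_mem' := by
    rintro c n ⟨h1, h2, h3⟩
    refine ⟨?_, ?_, ?_⟩ <;> simp only [Pi.smul_apply, smul_eq_mul]
    · linear_combination c * h1
    · linear_combination c * h2
    · linear_combination c * h3

/-- The conditions in `typeCoeffs` are the eigenvalue equations on `frame 0`, `frame 2`, `frame 4`.
Those on the other three frame vectors follow from `μ² = -1` and `s² + c² = 1`. -/
theorem coframeCov_Jt {t : ℝ} {μ : ℂ} (hμ : μ * μ = -1) {n : Fin 4 → ℂ} (hn : n ∈ typeCoeffs t μ)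
    (x v : G) : coframeCov n x (Jt t x v) = μ * coframeCov n x v := by
  obtain ⟨h1, h2, h3⟩ := hn
  have h : (Real.sin (Real.pi * t) : ℂ) ^ 2 + (Real.cos (Real.pi * t) : ℂ) ^ 2 = 1 := by
    exact_mod_cast Real.sin_sq_add_cos_sq (Real.pi * t)
  simp [coframeCov_apply, e_Jt, Fin.sum_univ_succ, JMatrix, -Complex.ofReal_cos,
    -Complex.ofReal_sin]
  generalize (Real.cos (Real.pi * t) : ℂ) = c at *
  generalize (Real.sin (Real.pi * t) : ℂ) = s at *
  have h5 : -n 0 = μ * n 1 := by linear_combination -μ * h1 - n 0 * hμ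
  have h6 : s * n 2 = 0 := by linear_combination -c * μ * h3 + s * μ * h2 + s * n 2 * hμ
  have h7 : -(c * n 2) = μ * n 3 := by
    linear_combination -c * μ * h2 - c * n 2 * hμ - μ * s * h3 + μ * n 3 * h
  linear_combination (e 1 x v : ℂ) * h5 + e 0 x v * h1 + e 3 x v * h7 + e 2 x v * h2
    - e 5 x v * h6 - e 4 x v * h3

theorem mem_typeCoeffs {t : ℝ} {μ : ℂ} {α : closedForms 1}
    (hα : ∀ x v, toCov (α.1.toFun x) (Jt t x v) = μ * toCov (α.1.toFun x) v) {n : Fin 4 → ℂ}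
    {F : G → ℂ} (hF : ContDiff ℝ ∞ F) (hi : IsInvariantFun F)
    (h : ∀ x, toCov (α.1.toFun x) = coframeCov n x + fderiv ℝ F x) : n ∈ typeCoeffs t μ := by
  have h0 (x : G) := hα x (frame 0 x)
  have h2 (x : G) := hα x (frame 2 x)
  have h4 (x : G) := hα x (frame 4 x)
  simp [Jt_frame, Fin.sum_univ_succ, JMatrix, -Complex.ofReal_cos, -Complex.ofReal_sin, h,
    coframeCov_frame] at h0 h2 h4
  refine ⟨?_, ?_, ?_⟩
  · rw [← sub_eq_zero]
    refine eq_zero_of_base_derivative hF hi (w := ![μ, -1]) fun x => ?_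
    simp
    linear_combination -h0 x
  · rw [← sub_eq_zero]
    refine eq_zero_of_fibre_derivative hF hi
      -- The weights are the coefficients of the derivatives of `F` when the equation on `frame 2`
      -- is solved for its constant part.
      (w := ![μ, -(Real.cos (Real.pi * t) : ℂ), 0, -(Real.sin (Real.pi * t) : ℂ)]) fun x => ?_
    simp [-Complex.ofReal_cos, -Complex.ofReal_sin]
    linear_combination -h2 x
  · refine eq_zero_of_fibre_derivative hF hi
      (w := ![0, -(Real.sin (Real.pi * t) : ℂ), -μ, (Real.cos (Real.pi * t) : ℂ)]) fun x => ?_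
    simp [-Complex.ofReal_cos, -Complex.ofReal_sin]
    linear_combination h4 x

theorem HType_eq_map_typeCoeffs {t : ℝ} {μ : ℂ} (hμ : μ * μ = -1) {p q : ℕ}
    (h : ∀ x (α : AForm 1), α ∈ typed (Jt t x) 1 p q ↔ ∀ v, toCov α (Jt t x v) = μ * toCov α v) :
    HType (Jt t) 1 p q = (typeCoeffs t μ).map coframeClass := by
  refine le_antisymm ?_ ?_
  · rintro _ ⟨α, hα, rfl⟩
    obtain ⟨n, F, hF, hi, hα'⟩ := exists_eq_coframeCov_add α
    refine ⟨n, mem_typeCoeffs (fun x => (h x _).1 (hα x)) hF hi hα', ?_⟩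
    exact (cls_eq_coframeClass hF hi hα').symm
  · rintro _ ⟨n, hn, rfl⟩
    exact ⟨closedCoframe n, fun x => (h x _).2 (coframeCov_Jt hμ hn x), rfl⟩

theorem HType_one_one_zero (t : ℝ) :
    HType (Jt t) 1 1 0 = (typeCoeffs t Complex.I).map coframeClass :=
  HType_eq_map_typeCoeffs (by simp) fun _ _ => mem_typed_one_one_zero

theorem HType_one_zero_one (t : ℝ) :
    HType (Jt t) 1 0 1 = (typeCoeffs t (-Complex.I)).map coframeClass :=
  HType_eq_map_typeCoeffs (by simp) fun _ _ => mem_typed_one_zero_one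

theorem finrank_map_coframeClass (W : Submodule ℂ (Fin 4 → ℂ)) :
    Module.finrank ℂ (W.map coframeClass) = Module.finrank ℂ W :=
  (Submodule.equivMapOfInjective _ coframeClass_injective W).finrank_eq.symm

/-- The drop in dimension: `s n₃ = 0` now gives `n₃ = 0`, and then `μ n₂ = c n₃` gives `n₂ = 0`. -/
theorem typeCoeffs_of_sin_ne_zero {t : ℝ} (hs : Real.sin (Real.pi * t) ≠ 0) {μ : ℂ}
    (hμ : μ * μ = -1) : typeCoeffs t μ = Submodule.span ℂ {![1, μ, 0, 0]} := by
  have hμ0 : μ ≠ 0 := by rintro rfl; simp at hμ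
  refine le_antisymm ?_ ?_
  · rintro n ⟨h1, h2, h3⟩
    have h4 : n 3 = 0 := by simpa [hs, -Complex.ofReal_sin] using h3
    have h5 : n 2 = 0 := by simpa [h4, hμ0] using h2
    rw [Submodule.mem_span_singleton]
    refine ⟨n 0, ?_⟩
    ext i
    fin_cases i <;> simp [h1, h4, h5, mul_comm]
  · rw [Submodule.span_singleton_le_iff_mem]
    refine ⟨?_, ?_, ?_⟩ <;> simp

theorem typeCoeffs_of_sin_eq_zero {t : ℝ} (hs : Real.sin (Real.pi * t) = 0) {μ : ℂ} :
    typeCoeffs t μ =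
      Submodule.span ℂ {![1, μ, 0, 0], ![0, 0, 1, μ * (Real.cos (Real.pi * t) : ℂ)]} := by
  have h : (Real.cos (Real.pi * t) : ℂ) * (Real.cos (Real.pi * t) : ℂ) = 1 := by
    have := Real.sin_sq_add_cos_sq (Real.pi * t)
    rw [hs] at this
    exact_mod_cast (by linarith : Real.cos (Real.pi * t) * Real.cos (Real.pi * t) = 1)
  refine le_antisymm ?_ ?_
  · rintro n ⟨h1, h2, h3⟩
    rw [Submodule.mem_span_pair]
    refine ⟨n 0, n 2, ?_⟩
    ext i
    fin_cases i <;> simp [h1, -Complex.ofReal_cos]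
    · ring
    · linear_combination -(Real.cos (Real.pi * t) : ℂ) * h2 + n 3 * h
  · rw [Submodule.span_le, Set.pair_subset_iff]
    refine ⟨⟨?_, ?_, ?_⟩, ⟨?_, ?_, ?_⟩⟩ <;>
      simp [hs, -Complex.ofReal_sin, -Complex.ofReal_cos]
    linear_combination μ * h

theorem finrank_typeCoeffs_of_sin_ne_zero {t : ℝ} (hs : Real.sin (Real.pi * t) ≠ 0) {μ : ℂ}
    (hμ : μ * μ = -1) : Module.finrank ℂ (typeCoeffs t μ) = 1 := by
  rw [typeCoeffs_of_sin_ne_zero hs hμ]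
  refine finrank_span_singleton fun h => ?_
  simpa using congrFun h 0

theorem finrank_typeCoeffs_of_sin_eq_zero {t : ℝ} (hs : Real.sin (Real.pi * t) = 0) {μ : ℂ} :
    Module.finrank ℂ (typeCoeffs t μ) = 2 := by
  rw [typeCoeffs_of_sin_eq_zero hs]
  have hli : LinearIndependent ℂ
      ![![1, μ, 0, 0], ![0, 0, 1, μ * (Real.cos (Real.pi * t) : ℂ)]] := by
    rw [LinearIndependent.pair_iff]
    intro a b hab
    exact ⟨by simpa using congrFun hab 0, by simpa using congrFun hab 2⟩
  have := finrank_span_eq_card hli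
  rwa [Matrix.range_cons_cons_empty, Fintype.card_fin] at this

/-- Both types have coefficients in the hyperplane `n₃ = 0`, so the class of `e⁴` is not reached. -/
theorem not_isFullAtStage_one {t : ℝ} (hs : Real.sin (Real.pi * t) ≠ 0) :
    ¬ IsFullAtStage (Jt t) 1 := by
  intro h
  let K : Submodule ℂ (Fin 4 → ℂ) := LinearMap.ker (LinearMap.proj 3)
  have hK (μ : ℂ) : typeCoeffs t μ ≤ K := by
    rintro n ⟨-, -, h3⟩
    simpa [hs, -Complex.ofReal_sin, K] using h3
  have hle : (⊤ : Submodule ℂ (DeRham 1)) ≤ K.map coframeClass := by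
    rw [← h]
    refine iSup_le fun p => iSup_le fun q => iSup_le fun hpq => ?_
    obtain ⟨rfl, rfl⟩ | ⟨rfl, rfl⟩ : (p = 1 ∧ q = 0) ∨ (p = 0 ∧ q = 1) := by omega
    · rw [HType_one_one_zero]
      exact Submodule.map_mono (hK _)
    · rw [HType_one_zero_one]
      exact Submodule.map_mono (hK _)
  obtain ⟨n, hn, hn'⟩ := hle (Submodule.mem_top (x := coframeClass (Pi.single 3 1)))
  rw [coframeClass_injective hn'] at hn
  simp [K] at hn

/-! ### The weight decomposition of forms of mixed degree -/

/-- The derivation of the exterior algebra that extends `ξ ↦ ξ ∘ J`, evaluated at `v`. -/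
def derivJ (J : G →L[ℝ] G) {k : ℕ} (α : AForm k) (v : Fin k → G) : ℂ :=
  ∑ i, α (Function.update v i (J (v i)))

theorem derivJ_add (J : G →L[ℝ] G) {k : ℕ} (α β : AForm k) (v : Fin k → G) :
    derivJ J (α + β) v = derivJ J α v + derivJ J β v := by
  simp [derivJ, Finset.sum_add_distrib]

theorem derivJ_smul (J : G →L[ℝ] G) {k : ℕ} (c : ℂ) (α : AForm k) (v : Fin k → G) :
    derivJ J (c • α) v = c * derivJ J α v := by
  simp [derivJ, Finset.mul_sum]

theorem curryLeft_apply {k : ℕ} (α : AForm (k + 1)) (x : G) (v : Fin k → G) :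
    α.curryLeft x v = α (Fin.cons x v) := rfl

theorem derivJ_curryLeft (J : G →L[ℝ] G) {k : ℕ} (α : AForm (k + 1)) (x : G) (v : Fin k → G) :
    derivJ J (α.curryLeft x) v = derivJ J α (Fin.cons x v) - α.curryLeft (J x) v := by
  simp only [derivJ, curryLeft_apply, Fin.sum_univ_succ, Fin.cons_update, Fin.cons_zero,
    Fin.cons_succ, Fin.update_cons_zero]
  ring

theorem derivJ_wedge (J : G →L[ℝ] G) {k : ℕ} (ξ : G →L[ℝ] ℂ) (α : AForm k)
    (v : Fin (k + 1) → G) : derivJ J (wedge ξ α) v = wedge (ξ.comp J) α v +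
      ∑ i : Fin (k + 1), (-1) ^ (i : ℕ) * (ξ (v i) * derivJ J α (i.removeNth v)) := by
  simp only [derivJ, wedge_apply]
  rw [Finset.sum_comm, ← Finset.sum_add_distrib]
  refine Finset.sum_congr rfl fun i _ => ?_
  rw [← Finset.mul_sum, ← mul_add]
  congr 1
  rw [Fin.sum_univ_succAbove _ i]
  congr 1
  · simp
  · rw [Finset.mul_sum]
    refine Finset.sum_congr rfl fun j _ => ?_
    have h1 : Function.update v (i.succAbove j) (J (v (i.succAbove j))) i = v i :=
      Function.update_of_ne (Fin.ne_succAbove i j) _ _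
    rw [h1, Fin.removeNth_update_succAbove]
    rfl

/-- All components of `φ` have weight `w` for the derivation that extends `ξ ↦ ξ ∘ J`. -/
def HasWeight (J : G →L[ℝ] G) (w : ℂ) (φ : MixedForm) : Prop :=
  ∀ k v, derivJ J (φ k) v = w * φ k v

theorem HasWeight.add {J : G →L[ℝ] G} {w : ℂ} {φ ψ : MixedForm} (hφ : HasWeight J w φ)
    (hψ : HasWeight J w ψ) : HasWeight J w (φ + ψ) := fun k v => by
  simp [derivJ_add, hφ k v, hψ k v, mul_add]

theorem HasWeight.smul {J : G →L[ℝ] G} {w : ℂ} {φ : MixedForm} (c : ℂ) (hφ : HasWeight J w φ) :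
    HasWeight J w (c • φ) := fun k v => by
  simp [derivJ_smul, hφ k v, mul_left_comm]

theorem HasWeight.zero {J : G →L[ℝ] G} {w : ℂ} : HasWeight J w 0 := fun k v => by
  simp [derivJ]

/-- The action of an almost-complex structure on `T ⊕ T*`. -/
abbrev genJ (J : G →L[ℝ] G) : GenTangent →L[ℝ] GenTangent :=
  ContinuousLinearMap.prodMap (-J) (ContinuousLinearMap.precomp ℝ J)

/-- The commutator of the derivation with `ι_X` is `-ι_{JX}` and with `ξ ∧` is `(ξ ∘ J) ∧`; the
signs match those of `genJ`. -/
theorem derivJ_clifford {J : G →L[ℝ] G} {w : ℂ} {φ : MixedForm} (hφ : HasWeight J w φ)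
    (v : GenTangent) (k : ℕ) (u : Fin k → G) :
    derivJ J (clifford v φ k) u = clifford (genJ J v) φ k u + w * clifford v φ k u := by
  have hc (k : ℕ) (u : Fin k → G) : derivJ J ((φ (k + 1)).curryLeft v.1) u
      = (φ (k + 1)).curryLeft (-(J v.1)) u + w * (φ (k + 1)).curryLeft v.1 u := by
    rw [derivJ_curryLeft, hφ, map_neg]
    simp only [curryLeft_apply, ContinuousAlternatingMap.neg_apply]
    ring
  cases k with
  | zero => exact hc 0 u
  | succ k =>
    change derivJ J ((φ (k + 2)).curryLeft v.1 + wedge (Complex.ofRealCLM.comp v.2) (φ k)) u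
      = ((φ (k + 2)).curryLeft (-(J v.1))
          + wedge (Complex.ofRealCLM.comp (v.2.comp J)) (φ k)) u
        + w * ((φ (k + 2)).curryLeft v.1 + wedge (Complex.ofRealCLM.comp v.2) (φ k)) u
    rw [derivJ_add, hc, derivJ_wedge]
    have h : ∑ i : Fin (k + 1), (-1) ^ (i : ℕ) * ((Complex.ofRealCLM.comp v.2) (u i)
          * derivJ J (φ k) (i.removeNth u))
        = w * wedge (Complex.ofRealCLM.comp v.2) (φ k) u := by
      rw [wedge_apply, Finset.mul_sum]
      refine Finset.sum_congr rfl fun i _ => ?_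
      rw [hφ]
      ring
    rw [h, ContinuousAlternatingMap.add_apply, ContinuousAlternatingMap.add_apply]
    rw [ContinuousLinearMap.comp_assoc]
    ring

theorem derivJ_cliffordC {J : G →L[ℝ] G} {w : ℂ} {φ : MixedForm} (hφ : HasWeight J w φ)
    (v : ℂ ⊗[ℝ] GenTangent) (k : ℕ) (u : Fin k → G) :
    derivJ J (cliffordC v φ k) u
      = cliffordC ((genJ J : GenTangent →ₗ[ℝ] GenTangent).baseChange ℂ v) φ k u
        + w * cliffordC v φ k u := by
  induction v with
  | zero => simp [derivJ]
  | tmul c v =>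
    simp only [cliffordC, LinearMap.baseChange_tmul, LinearMap.liftBaseChange_tmul,
      LinearMap.smul_apply, Pi.smul_apply, ContinuousAlternatingMap.smul_apply, derivJ_smul,
      derivJ_clifford hφ, smul_eq_mul, ContinuousLinearMap.coe_coe]
    ring
  | add v v' h h' =>
    simp only [map_add, LinearMap.add_apply, Pi.add_apply, derivJ_add, h, h',
      ContinuousAlternatingMap.add_apply]
    ring

theorem hasWeight_cliffordC {J : G →L[ℝ] G} {w : ℂ} {φ : MixedForm} (hφ : HasWeight J w φ)
    {v : ℂ ⊗[ℝ] GenTangent} (hv : v ∈ eigenbundle (genJ J) (-Complex.I)) :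
    HasWeight J (w - Complex.I) (cliffordC v φ) := by
  intro k u
  have h := Module.End.mem_eigenspace_iff.1 hv
  rw [derivJ_cliffordC hφ, h, map_smul]
  simp only [LinearMap.smul_apply, Pi.smul_apply, ContinuousAlternatingMap.smul_apply,
    smul_eq_mul]
  ring

/-! ### The canonical line -/

/-- Up to a factor 2 this is the projection of `v` to the `i`-eigenspace; it supplies the elements
of `L` that test membership in the canonical line. -/
theorem tmul_sub_mem_eigenbundle {J : G →L[ℝ] G} (hJ : ∀ v, J (J v) = -v) (v : GenTangent) :
    (1 : ℂ) ⊗ₜ[ℝ] v - Complex.I ⊗ₜ[ℝ] (genJ J v) ∈ eigenbundle (genJ J) Complex.I := by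
  have hsq : genJ J (genJ J v) = -v := by
    refine Prod.ext ?_ ?_
    · simp [hJ]
    · ext1 u
      simp [hJ]
  rw [eigenbundle, Module.End.mem_eigenspace_iff, map_sub, LinearMap.baseChange_tmul,
    LinearMap.baseChange_tmul, ContinuousLinearMap.coe_coe, hsq, smul_sub, TensorProduct.smul_tmul',
    TensorProduct.smul_tmul', smul_eq_mul, smul_eq_mul, Complex.I_mul_I, TensorProduct.tmul_neg,
    TensorProduct.neg_tmul, mul_one]
  abel

theorem clifford_genJ_of_mem_canonicalLine {J : G →L[ℝ] G} (hJ : ∀ v, J (J v) = -v)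
    {φ : MixedForm} (hφ : φ ∈ canonicalLine (genJ J)) (v : GenTangent) :
    clifford v φ = Complex.I • clifford (genJ J v) φ := by
  simp only [canonicalLine, Submodule.mem_iInf, LinearMap.mem_ker] at hφ
  have h := hφ _ (tmul_sub_mem_eigenbundle hJ v)
  rw [map_sub, cliffordC, LinearMap.liftBaseChange_tmul, LinearMap.liftBaseChange_tmul, one_smul,
    LinearMap.sub_apply, LinearMap.smul_apply, sub_eq_zero] at h
  exact h

theorem curryLeft_of_mem_canonicalLine {J : G →L[ℝ] G} (hJ : ∀ v, J (J v) = -v)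
    {φ : MixedForm} (hφ : φ ∈ canonicalLine (genJ J)) (k : ℕ) (x : G) :
    (φ (k + 1)).curryLeft (J x) = Complex.I • (φ (k + 1)).curryLeft x := by
  have h := congrFun (clifford_genJ_of_mem_canonicalLine hJ hφ (x, 0)) k
  have h' : (φ (k + 1)).curryLeft x = Complex.I • (φ (k + 1)).curryLeft (-(J x)) := by
    cases k with
    | zero => exact h
    | succ k =>
      have hw : wedge (0 : G →L[ℝ] ℂ) (φ k) = 0 := by
        ext v
        simp [wedge_apply]
      have h1 : clifford (x, 0) φ (k + 1) = (φ (k + 2)).curryLeft x := by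
        change (φ (k + 2)).curryLeft x + wedge (Complex.ofRealCLM.comp (0 : G →L[ℝ] ℝ)) (φ k) = _
        rw [ContinuousLinearMap.comp_zero, hw, add_zero]
      have h2 : clifford (genJ J (x, 0)) φ (k + 1) = (φ (k + 2)).curryLeft (-(J x)) := by
        change (φ (k + 2)).curryLeft (-(J x))
          + wedge (Complex.ofRealCLM.comp ((0 : G →L[ℝ] ℝ).comp J)) (φ k) = _
        rw [ContinuousLinearMap.zero_comp, ContinuousLinearMap.comp_zero, hw, add_zero]
      rw [← h1, ← h2]
      exact h
  rw [map_neg] at h'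
  rw [h', smul_smul, Complex.I_mul_I]
  simp

/-- Moving slot `i` to the front costs `(-1)^i`. -/
theorem map_update_eq {k : ℕ} (α : AForm (k + 1)) (v : Fin (k + 1) → G) (i : Fin (k + 1)) (x : G) :
    α (Function.update v i x) = (-1) ^ (i : ℕ) * α.curryLeft x (i.removeNth v) := by
  rw [curryLeft_apply, ← Fin.insertNth_removeNth, α.map_insertNth]
  simp
  rfl

theorem derivJ_of_mem_canonicalLine {J : G →L[ℝ] G} (hJ : ∀ v, J (J v) = -v)
    {φ : MixedForm} (hφ : φ ∈ canonicalLine (genJ J)) (k : ℕ) (v : Fin k → G) :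
    derivJ J (φ k) v = k * Complex.I * φ k v := by
  cases k with
  | zero => simp [derivJ]
  | succ k =>
    have h (i : Fin (k + 1)) :
        φ (k + 1) (Function.update v i (J (v i))) = Complex.I * φ (k + 1) v := by
      have h1 := map_update_eq (φ (k + 1)) v i (v i)
      rw [Function.update_eq_self] at h1
      rw [map_update_eq, curryLeft_of_mem_canonicalLine hJ hφ, h1]
      simp only [ContinuousAlternatingMap.smul_apply, smul_eq_mul]
      ring
    simp [derivJ, h]
    ring

theorem wedge_of_mem_canonicalLine {J : G →L[ℝ] G} (hJ : ∀ v, J (J v) = -v)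
    {φ : MixedForm} (hφ : φ ∈ canonicalLine (genJ J)) (k : ℕ) (ξ : G →L[ℝ] ℝ) :
    wedge (Complex.ofRealCLM.comp ξ) (φ k)
      = Complex.I • wedge (Complex.ofRealCLM.comp (ξ.comp J)) (φ k) := by
  have h := congrFun (clifford_genJ_of_mem_canonicalLine hJ hφ (0, ξ)) (k + 1)
  have h1 : clifford (0, ξ) φ (k + 1) = wedge (Complex.ofRealCLM.comp ξ) (φ k) := by
    change (φ (k + 2)).curryLeft 0 + _ = _
    rw [map_zero, zero_add]
  have h2 : clifford (genJ J (0, ξ)) φ (k + 1)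
      = wedge (Complex.ofRealCLM.comp (ξ.comp J)) (φ k) := by
    change (φ (k + 2)).curryLeft (-(J 0)) + _ = _
    rw [map_zero, neg_zero, map_zero, zero_add]
    rfl
  rw [← h1, ← h2]
  exact h

/-- The contraction of `e^j ∘ A ∧ α` with the frame, summed over the frame. -/
theorem sum_wedge_frame (A : G →L[ℝ] G) {k : ℕ} (α : AForm k) (x : G) (v : Fin k → G) :
    ∑ j, wedge (Complex.ofRealCLM.comp ((e j x).comp A)) α (Fin.cons (frame j x) v)
      = (∑ j, e j x (A (frame j x)) : ℝ) * α v - derivJ A α v := by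
  have h (j : Fin 6) : wedge (Complex.ofRealCLM.comp ((e j x).comp A)) α (Fin.cons (frame j x) v)
      = (e j x (A (frame j x)) : ℂ) * α v
        - ∑ i : Fin k, (e j x (A (v i)) : ℂ) * α (Function.update v i (frame j x)) := by
    rw [wedge_apply, Fin.sum_univ_succ, sub_eq_add_neg, ← Finset.sum_neg_distrib]
    congr 1
    · simp
    · refine Finset.sum_congr rfl fun i _ => ?_
      cases k with
      | zero => exact i.elim0
      | succ k =>
        have hr : Fin.removeNth i.succ (Fin.cons (frame j x) v : Fin (k + 2) → G)
            = Fin.cons (frame j x) (i.removeNth v) := by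
          funext l
          refine Fin.cases ?_ (fun l => ?_) l <;> simp [Fin.removeNth]
        rw [hr, map_update_eq, curryLeft_apply, Fin.cons_succ, Fin.val_succ, pow_succ]
        simp
        ring
  simp only [h]
  rw [Finset.sum_sub_distrib, ← Finset.sum_mul, Finset.sum_comm, Complex.ofReal_sum]
  congr 1
  refine Finset.sum_congr rfl fun i _ => ?_
  -- In slot `i` the frame expansion of `A (v i)` reassembles, which gives the `i`-th term of the
  -- derivation.
  have hs := map_eq_sum_frame (α.toContinuousLinearMap v i) x (A (v i))
  simpa using hs.symm

/-- Apply `sum_wedge_frame` with the identity and with `J`. Since `ξ ∧ φ = i (ξ ∘ J) ∧ φ` on the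
canonical line, comparison gives `6 - k = i (tr J - k i)` on a nonzero component of degree `k`,
whence `k = 3`. -/
theorem apply_eq_zero_of_mem_canonicalLine {J : G →L[ℝ] G} (hJ : ∀ v, J (J v) = -v)
    {φ : MixedForm} (hφ : φ ∈ canonicalLine (genJ J)) {k : ℕ} (hk : k ≠ 3) : φ k = 0 := by
  ext v
  have h1 := sum_wedge_frame (ContinuousLinearMap.id ℝ G) (φ k) 0 v
  have h2 := sum_wedge_frame J (φ k) 0 v
  have hw (j : Fin 6) := wedge_of_mem_canonicalLine hJ hφ k (e j 0)
  simp only [ContinuousLinearMap.comp_id, hw,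
    ContinuousAlternatingMap.smul_apply, ← Finset.smul_sum, h2] at h1
  rw [derivJ_of_mem_canonicalLine hJ hφ] at h1
  have h3 : derivJ (ContinuousLinearMap.id ℝ G) (φ k) v = k * φ k v := by
    simp [derivJ]
  simp only [h3, ContinuousLinearMap.id_apply, e_frame, smul_eq_mul] at h1
  simp only [if_true, Finset.sum_const, Finset.card_univ, Fintype.card_fin, nsmul_eq_mul, mul_one]
    at h1
  -- The trace of `J` need not be evaluated: it is real, so it only enters the imaginary part of the
  -- scalar in `h4`.
  generalize (∑ j, e j 0 (J (frame j 0))) = T at h1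
  have h4 : ((2 * k - 6 : ℝ) + Complex.I * T : ℂ) * φ k v = 0 := by
    push_cast at h1 ⊢
    linear_combination h1 + k * φ k v * Complex.I_mul_I
  rcases mul_eq_zero.1 h4 with h5 | h5
  · have := congrArg Complex.re h5
    simp at this
    exact absurd (by exact_mod_cast (by linarith : (k : ℝ) = 3)) hk
  · exact h5

theorem hasWeight_of_mem_canonicalLine {J : G →L[ℝ] G} (hJ : ∀ v, J (J v) = -v)
    {φ : MixedForm} (hφ : φ ∈ canonicalLine (genJ J)) : HasWeight J (3 * Complex.I) φ := by
  intro k v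
  rw [derivJ_of_mem_canonicalLine hJ hφ]
  by_cases hk : k = 3
  · subst hk
    norm_num
  · simp [apply_eq_zero_of_mem_canonicalLine hJ hφ hk]

theorem hasWeight_of_mem_spinorGrade {J : G →L[ℝ] G} (hJ : ∀ v, J (J v) = -v) {m : ℕ}
    {φ : MixedForm} (hφ : φ ∈ spinorGrade (genJ J) m) :
    HasWeight J ((3 - m : ℂ) * Complex.I) φ := by
  induction m generalizing φ with
  | zero =>
    have := hasWeight_of_mem_canonicalLine hJ hφ
    simpa using this
  | succ m ih =>
    rw [spinorGrade] at hφ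
    refine Submodule.span_induction (p := fun φ _ => HasWeight J _ φ) ?_ HasWeight.zero
      (fun _ _ _ _ h1 h2 => h1.add h2) (fun c _ _ h => h.smul c) hφ
    rintro _ ⟨v, hv, φ, hφ, rfl⟩
    have := hasWeight_cliffordC (ih hφ) hv
    convert this using 1
    push_cast
    ring

theorem toCov_of_mem_gradeU {J : G →L[ℝ] G} (hJ : ∀ v, J (J v) = -v) {k : ℤ} {φ : MixedForm}
    (hφ : φ ∈ gradeU (genJ J) k) (v : G) :
    toCov (φ 1) (J v) = k * Complex.I * toCov (φ 1) v := by
  rw [gradeU] at hφ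
  split_ifs at hφ with hk
  -- In degree one the derivation is just `ξ ↦ ξ ∘ J`, and `m = 3 - k` turns the weight `(3 - m) i`
  -- into `k i`. No lower bound on `k` is needed.
  · have h := hasWeight_of_mem_spinorGrade hJ hφ 1 fun _ => v
    have hc : ((3 - k).toNat : ℂ) = 3 - k := by
      have : ((3 - k).toNat : ℤ) = 3 - k := Int.toNat_of_nonneg (by omega)
      exact_mod_cast congrArg (Int.cast : ℤ → ℂ) this
    rw [hc] at h
    simpa [derivJ, apply_eq_toCov] using h
  · rw [Submodule.mem_bot] at hφ
    subst hφ
    change (0 : ℂ) = k * Complex.I * 0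
    rw [mul_zero]

/-! ### Generalized `C^∞`-fullness implies fullness at the first stage -/

/-- The component of degree one of a closed form of mixed degree. -/
def degreeOne : closedTotal →ₗ[ℂ] closedForms 1 :=
  ((LinearMap.proj 1).comp closedTotal.subtype).codRestrict _ fun α => by
    have h : dTotal α.1 2 = 0 := by
      rw [LinearMap.mem_ker.1 α.2]
      rfl
    exact LinearMap.mem_ker.2 h

/-- The projection of `GH_dR(M)` to the cohomology of degree one. -/
def degreeOneClass : GHdR →ₗ[ℂ] DeRham 1 :=
  Submodule.mapQ _ _ degreeOne <| by
    rintro α ⟨β, hβ⟩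
    exact ⟨β 0, congrFun hβ 1⟩

theorem degreeOneClass_surjective : Function.Surjective degreeOneClass := by
  intro c
  obtain ⟨α, rfl⟩ := Submodule.mkQ_surjective _ c
  have hα : Pi.single 1 α.1 ∈ closedTotal := by
    rw [LinearMap.mem_ker]
    funext k
    match k with
    | 0 => rfl
    | 1 =>
      change d 0 ((Pi.single 1 α.1 : TotalForms) 0) = 0
      simp
    | 2 =>
      change d 1 ((Pi.single 1 α.1 : TotalForms) 1) = 0
      rw [Pi.single_eq_same]
      exact LinearMap.mem_ker.1 α.2
    | k + 3 =>
      change d (k + 2) ((Pi.single 1 α.1 : TotalForms) (k + 2)) = 0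
      rw [Pi.single_eq_of_ne (by omega), map_zero]
  refine ⟨Submodule.Quotient.mk ⟨_, hα⟩, ?_⟩
  have : degreeOne ⟨_, hα⟩ = α := Subtype.ext (Pi.single_eq_same 1 α.1)
  exact congrArg (Submodule.mkQ _) this

theorem degreeOneClass_mem {J : G → G →L[ℝ] G} (hJ : ∀ x v, J x (J x v) = -v) {k : ℤ}
    {c : GHdR} (hc : c ∈ GH (genOfAlmostComplex J) k) :
    degreeOneClass c ∈ HType J 1 1 0 ⊔ HType J 1 0 1 := by
  obtain ⟨α, hα, rfl⟩ := hc
  have h (x v : G) : toCov ((degreeOne α).1.toFun x) (J x v)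
      = k * Complex.I * toCov ((degreeOne α).1.toFun x) v :=
    toCov_of_mem_gradeU (hJ x) (hα x) v
  change Submodule.mkQ _ (degreeOne α) ∈ _
  by_cases h1 : k = 1
  · refine Submodule.mem_sup_left ⟨degreeOne α, fun x => ?_, rfl⟩
    refine mem_typed_one_one_zero.2 fun v => ?_
    simpa [h1] using h x v
  by_cases h2 : k = -1
  · refine Submodule.mem_sup_right ⟨degreeOne α, fun x => ?_, rfl⟩
    refine mem_typed_one_zero_one.2 fun v => ?_
    simpa [h2] using h x v
  have h0 : degreeOne α = 0 := by
    refine Subtype.ext (Forms.ext_toCov fun x => ?_)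
    ext1 v
    -- Using the eigenvalue equation twice gives `J² = -k²` against `J² = -1`, so a nonzero
    -- degree-one part forces `k = ±1`.
    have h3 := h x (J x v)
    rw [hJ, map_neg, h] at h3
    have hk : ((k : ℂ) ^ 2 - 1) * toCov ((degreeOne α).1.toFun x) v = 0 := by
      linear_combination h3 + k ^ 2 * toCov ((degreeOne α).1.toFun x) v * Complex.I_mul_I
    rcases mul_eq_zero.1 hk with h4 | h4
    · have h5 : k ^ 2 = 1 ^ 2 := by
        have h6 : (k : ℂ) ^ 2 = 1 := sub_eq_zero.1 h4
        exact_mod_cast h6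
      rcases sq_eq_sq_iff_eq_or_eq_neg.1 h5 with h6 | h6
      · exact absurd h6 h1
      · exact absurd h6 h2
    · exact h4
  rw [h0, map_zero]
  exact zero_mem _

theorem IsGenFull.isFullAtStage_one {J : G → G →L[ℝ] G} (hJ : ∀ x v, J x (J x v) = -v)
    (h : IsGenFull (genOfAlmostComplex J)) : IsFullAtStage J 1 := by
  rw [IsFullAtStage, eq_top_iff]
  intro c _
  obtain ⟨b, rfl⟩ := degreeOneClass_surjective c
  have hle : (⊤ : Submodule ℂ GHdR)
      ≤ (HType J 1 1 0 ⊔ HType J 1 0 1).comap degreeOneClass := by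
    rw [← h]
    exact iSup_le fun k c hc => degreeOneClass_mem hJ hc
  refine (sup_le ?_ ?_ : HType J 1 1 0 ⊔ HType J 1 0 1 ≤ _) (hle (Submodule.mem_top (x := b)))
  · exact le_iSup_of_le 1 (le_iSup_of_le 0 (le_iSup_of_le rfl le_rfl))
  · exact le_iSup_of_le 0 (le_iSup_of_le 1 (le_iSup_of_le rfl le_rfl))

/-! ### The forms `φ_t¹`, `φ_t²` and their conjugates -/

theorem phi_zero_eq (t : ℝ) : phi t 0 = (closedCoframe ![1, Complex.I, 0, 0]).1.toFun := by
  rw [closedCoframe_toFun, phi]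
  congr 1
  funext x
  ext1 v
  simp [phiCov, coframeCov_apply]

theorem phiBar_zero_eq (t : ℝ) :
    phiBar t 0 = (closedCoframe ![1, -Complex.I, 0, 0]).1.toFun := by
  rw [closedCoframe_toFun, phiBar]
  congr 1
  funext x
  ext1 v
  simp [phiCov, coframeCov_apply, conjCov]

theorem phi_one_eq {t : ℝ} (hs : Real.sin (Real.pi * t) = 0) : phi t 1 =
    (closedCoframe ![0, 0, 1, Complex.I * (Real.cos (Real.pi * t) : ℂ)]).1.toFun := by
  rw [closedCoframe_toFun, phi]
  congr 1
  funext x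
  ext1 v
  simp [phiCov, coframeCov_apply, hs, mul_assoc, -Complex.ofReal_cos]

theorem phiBar_one_eq {t : ℝ} (hs : Real.sin (Real.pi * t) = 0) : phiBar t 1 =
    (closedCoframe ![0, 0, 1, -Complex.I * (Real.cos (Real.pi * t) : ℂ)]).1.toFun := by
  rw [closedCoframe_toFun, phiBar]
  congr 1
  funext x
  ext1 v
  simp [phiCov, coframeCov_apply, conjCov, hs, mul_assoc, -Complex.ofReal_cos]

end Iwasawa

end

/-! ### Assembly of the statements on the curve `J_t`. -/

theorem mainTheorem7 :
    -- `J_t`, `t ∈ [0,1]`, is a curve of left-invariant almost-complex structures on `M`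
    ContDiff ℝ ∞ (fun p : ℝ × G => Jt p.1 p.2) ∧
    (∀ t ∈ Set.Icc (0 : ℝ) 1,
      IsAlmostComplex (Jt t) ∧ IsLeftInvariant (Jt t) ∧
      IsGenAlmostComplex (genOfAlmostComplex (Jt t)) ∧
      ∀ x, covectors10 (Jt t x) = Submodule.span ℂ (Set.range fun j => phiCov t j x)) ∧
    -- `J_0` is the holomorphically-parallelizable structure of the Iwasawa manifold
    (∀ x v, Jt 0 x v = Complex.I • v) ∧
    (∀ x, (e 0 x).comp (Jt 0 x) = -e 1 x ∧ (e 2 x).comp (Jt 0 x) = -e 3 x ∧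
      (e 4 x).comp (Jt 0 x) = -e 5 x) ∧
    IsHolomorphicallyParallelizable (Jt 0) ∧
    -- `J_1` is the Abelian complex structure
    (∀ x, (e 0 x).comp (Jt 1 x) = -e 1 x ∧ (e 2 x).comp (Jt 1 x) = e 3 x ∧
      (e 4 x).comp (Jt 1 x) = e 5 x) ∧
    IsAbelian (Jt 1) ∧
    -- the subgroups `H^{(1,0)}` and `H^{(0,1)}` at the endpoints
    (∀ t ∈ ({0, 1} : Set ℝ), ∃ a b a' b' : closedForms 1,
      a.1.toFun = phi t 0 ∧ b.1.toFun = phi t 1 ∧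
      a'.1.toFun = phiBar t 0 ∧ b'.1.toFun = phiBar t 1 ∧
      HType (Jt t) 1 1 0 = Submodule.span ℂ {cls a, cls b} ∧
      HType (Jt t) 1 0 1 = Submodule.span ℂ {cls a', cls b'} ∧
      Module.finrank ℂ (HType (Jt t) 1 1 0) = 2 ∧
      Module.finrank ℂ (HType (Jt t) 1 0 1) = 2) ∧
    -- in the interior of the curve
    (∀ t ∈ Set.Ioo (0 : ℝ) 1,
      (∃ a a' : closedForms 1,
        a.1.toFun = phi t 0 ∧ a'.1.toFun = phiBar t 0 ∧
        HType (Jt t) 1 1 0 = Submodule.span ℂ {cls a} ∧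
        HType (Jt t) 1 0 1 = Submodule.span ℂ {cls a'}) ∧
      Module.finrank ℂ (HType (Jt t) 1 1 0) = 1 ∧
      Module.finrank ℂ (HType (Jt t) 1 0 1) = 1 ∧
      ¬ IsFullAtStage (Jt t) 1 ∧
      ¬ IsGenPureAndFull (genOfAlmostComplex (Jt t))) := by

  have hII : Complex.I * Complex.I = -1 := Complex.I_mul_I
  have hII' : -Complex.I * -Complex.I = -1 := by simp
  refine ⟨contDiff_Jt, fun t _ => ⟨isAlmostComplex_Jt t, isLeftInvariant_Jt t,
    (isAlmostComplex_Jt t).isGenAlmostComplex, covectors10_Jt t⟩, Jt_zero, e_comp_Jt_zero,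
    isHolomorphicallyParallelizable_Jt_zero, e_comp_Jt_one, isAbelian_Jt_one, ?_, ?_⟩
  · intro t ht
    have hs : Real.sin (Real.pi * t) = 0 := by
      rcases ht with rfl | rfl <;> simp
    -- Unification fills the witnesses with the `closedCoframe` representatives; their coefficient
    -- vectors are the spanning vectors of `typeCoeffs`.
    refine ⟨_, _, _, _, (phi_zero_eq t).symm, (phi_one_eq hs).symm, (phiBar_zero_eq t).symm,
      (phiBar_one_eq hs).symm, ?_, ?_, ?_, ?_⟩
    · rw [HType_one_one_zero, typeCoeffs_of_sin_eq_zero hs, Submodule.map_span, Set.image_pair]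
      rfl
    · rw [HType_one_zero_one, typeCoeffs_of_sin_eq_zero hs, Submodule.map_span, Set.image_pair]
      rfl
    · rw [HType_one_one_zero, finrank_map_coframeClass, finrank_typeCoeffs_of_sin_eq_zero hs]
    · rw [HType_one_zero_one, finrank_map_coframeClass, finrank_typeCoeffs_of_sin_eq_zero hs]
  · rintro t ⟨h0, h1⟩
    have hs : Real.sin (Real.pi * t) ≠ 0 :=
      (Real.sin_pos_of_pos_of_lt_pi (by positivity) (by nlinarith [Real.pi_pos])).ne'
    refine ⟨⟨_, _, (phi_zero_eq t).symm, (phiBar_zero_eq t).symm, ?_, ?_⟩, ?_, ?_,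
      not_isFullAtStage_one hs,
      fun h => not_isFullAtStage_one hs (IsGenFull.isFullAtStage_one (Jt_Jt t) h.2)⟩
    · rw [HType_one_one_zero, typeCoeffs_of_sin_ne_zero hs hII, Submodule.map_span,
        Set.image_singleton]
      rfl
    · rw [HType_one_zero_one, typeCoeffs_of_sin_ne_zero hs hII', Submodule.map_span,
        Set.image_singleton]
      rfl
    · rw [HType_one_one_zero, finrank_map_coframeClass, finrank_typeCoeffs_of_sin_ne_zero hs hII]
    · rw [HType_one_zero_one, finrank_map_coframeClass, finrank_typeCoeffs_of_sin_ne_zero hs hII']
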